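/- Let $X\subset\mathbb{P}^3$ be a smooth quartic surface over $\mathbb{C}$, and let $l',l''$ be two disjoint lines contained in $X$. A \emph{symmetry} of $X$ is an automorphism $\tau\colon X\to X$ that is the restriction of an automorphism of $\mathbb{P}^3$ (an element of $\mathrm{PGL}_4(\mathbb{C})$), which is denoted by the same letter. It is \emph{symplectic} if it acts trivially on $H^{2,0}(X)$, the space of holomorphic $2$-forms on $X$. Write $\mathrm{Fix}(\tau,X)$ and $\mathrm{Fix}(\tau,\mathbb{P}^3)$ for the sets of fixed points of $\tau$ in $X$ and in $\mathbb{P}^3$. Then the following conditions are equivalent: (a) $l'$ and $l''$ are twin lines, i.e. there exist $10$ other distinct lines contained in $X$, each of which intersects both $l'$ and $l''$; (b) there exists a non-symplectic symmetry $\tau\colon X\to X$ of order $2$ such that $\mathrm{Fix}(\tau,X)=\mathrm{Fix}(\tau,\mathbb{P}^3)=l'\cup l''$. -/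

import Mathlib

open MvPolynomial
open scoped LinearAlgebra.Projectivization

noncomputable section

/-- The vector space `ℂ⁴` of homogeneous coordinates. -/
abbrev Vec4 : Type := Fin 4 → ℂ

/-- Complex projective space `ℙ³`. -/
abbrev P3 : Type := ℙ ℂ Vec4

/-- The automorphism group `PGL₄(ℂ)` of `ℙ³`: the permutations of `ℙ³` that are induced by an
invertible linear map of `ℂ⁴`. -/
def AutP3 : Subgroup (Equiv.Perm P3) :=
  (MulAction.toPermHom (Vec4 ≃ₗ[ℂ] Vec4) P3).range

/-- A line in `ℙ³`: the set of points lying in a two-dimensional subspace of `ℂ⁴`. -/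
def IsLine (l : Set P3) : Prop :=
  ∃ L : Submodule ℂ Vec4, Module.finrank ℂ L = 2 ∧ l = {p | p.submodule ≤ L}

/-- The differential at `v` of a polynomial function on `ℂ⁴`. -/
def polyDiff (F : MvPolynomial (Fin 4) ℂ) (v : Vec4) : Vec4 →ₗ[ℂ] ℂ :=
  ∑ i, eval v (pderiv i F) • LinearMap.proj i

/-- A smooth quartic surface in `ℙ³`, given by its equation: a quartic form whose partial
derivatives have no common zero on the surface. -/
structure SmoothQuartic where
  /-- The equation. -/
  poly : MvPolynomial (Fin 4) ℂ
  homogeneous : poly.IsHomogeneous 4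
  smooth : ∀ v : Vec4, v ≠ 0 → eval v poly = 0 → ∃ i, eval v (pderiv i poly) ≠ 0

theorem hasStrictFDerivAt_eval (F : MvPolynomial (Fin 4) ℂ) (v : Vec4) :
    HasStrictFDerivAt (fun x : Vec4 => eval x F)
      (LinearMap.toContinuousLinearMap (polyDiff F v)) v := by
  induction F using MvPolynomial.induction_on with
  | C a =>
    have h : LinearMap.toContinuousLinearMap (polyDiff (C a) v) = 0 := by
      ext w; simp [polyDiff]
    rw [h]
    simpa using hasStrictFDerivAt_const (𝕜 := ℂ) a v
  | add p q hp hq =>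
    have h : LinearMap.toContinuousLinearMap (polyDiff (p + q) v) =
        LinearMap.toContinuousLinearMap (polyDiff p v) +
        LinearMap.toContinuousLinearMap (polyDiff q v) := by
      ext w; simp [polyDiff, add_mul, Finset.sum_add_distrib]
    rw [h]
    have h2 : (fun x : Vec4 => eval x (p + q)) = (fun x => eval x p) + fun x => eval x q := by
      ext x; simp
    rw [h2]
    exact hp.add hq
  | mul_X p i hp =>
    have hi : HasStrictFDerivAt (fun x : Vec4 => x i)
        (ContinuousLinearMap.proj (R := ℂ) i : Vec4 →L[ℂ] ℂ) v :=
      (ContinuousLinearMap.proj (R := ℂ) i : Vec4 →L[ℂ] ℂ).hasStrictFDerivAt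
    have h : LinearMap.toContinuousLinearMap (polyDiff (p * X i) v) =
        eval v p • (ContinuousLinearMap.proj (R := ℂ) i : Vec4 →L[ℂ] ℂ) +
        v i • LinearMap.toContinuousLinearMap (polyDiff p v) := by
      ext w
      simp [polyDiff, pderiv_X, Pi.single_apply, add_mul, Finset.sum_add_distrib,
        Finset.mul_sum, apply_ite, mul_assoc]
    rw [h]
    have h2 : (fun x : Vec4 => eval x (p * X i)) = (fun x => eval x p) * fun x => x i := by
      ext x; simp
    rw [h2]
    exact hp.mul hi

theorem eval_smul_of_isHomogeneous {F : MvPolynomial (Fin 4) ℂ} {n : ℕ} (hF : F.IsHomogeneous n)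
    (c : ℂ) (v : Vec4) : eval (c • v) F = c ^ n * eval v F := by
  rw [eval_eq, eval_eq, Finset.mul_sum]
  refine Finset.sum_congr rfl fun d hd => ?_
  have hdeg : ∑ i ∈ d.support, d i = n := by
    rw [← hF (mem_support_iff.1 hd), Finsupp.weight_apply, Finsupp.sum]
    simp
  have : ∏ i ∈ d.support, (c • v) i ^ d i = c ^ n * ∏ i ∈ d.support, v i ^ d i := by
    simp [mul_pow, Finset.prod_mul_distrib, Finset.prod_pow_eq_pow_sum, hdeg]
  rw [this]
  ring

namespace SmoothQuartic

variable (X : SmoothQuartic)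

/-- The set of points of the surface `X` in `ℙ³`. -/
def surface : Set P3 := {p | eval p.rep X.poly = 0}

/-- The punctured affine cone over `X` in `ℂ⁴`. -/
def cone : Set Vec4 := {v | v ≠ 0 ∧ eval v X.poly = 0}

/-- The tangent space at `v` of the punctured affine cone over `X`. -/
def tangent (v : Vec4) : Submodule ℂ Vec4 := LinearMap.ker (polyDiff X.poly v)

theorem mk_mem_surface {v : Vec4} (hv : v ≠ 0) :
    Projectivization.mk ℂ v hv ∈ X.surface ↔ v ∈ X.cone := by
  obtain ⟨a, ha⟩ := Projectivization.exists_smul_eq_mk_rep ℂ v hv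
  have : eval (Projectivization.mk ℂ v hv).rep X.poly = (a : ℂ) ^ 4 * eval v X.poly := by
    rw [← ha]; exact eval_smul_of_isHomogeneous X.homogeneous _ _
  simp [surface, cone, this, hv]

/-- A linear map that preserves the punctured cone over `X` maps its tangent spaces to its
tangent spaces. -/
theorem map_mem_tangent (A : Vec4 ≃ₗ[ℂ] Vec4) (hA : ∀ v ∈ X.cone, A v ∈ X.cone)
    {v : Vec4} (hv : v ∈ X.cone) {w : Vec4} (hw : w ∈ X.tangent v) :
    A w ∈ X.tangent (A v) := by
  set A' : Vec4 →L[ℂ] Vec4 := LinearMap.toContinuousLinearMap A.toLinearMap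
  set f' := LinearMap.toContinuousLinearMap (polyDiff X.poly v)
  set g' := (LinearMap.toContinuousLinearMap (polyDiff X.poly (A v))).comp A'
  have hf : HasStrictFDerivAt (fun x : Vec4 => eval x X.poly) f' v :=
    hasStrictFDerivAt_eval _ _
  have hg : HasStrictFDerivAt (fun x : Vec4 => eval (A x) X.poly) g' v :=
    (hasStrictFDerivAt_eval X.poly (A' v)).comp v A'.hasStrictFDerivAt
  have hw' : f' w = 0 := hw
  change g' w = 0
  by_contra hgw
  obtain ⟨i, hi⟩ := X.smooth v hv.1 hv.2
  have hu : f' (Pi.single i 1) ≠ 0 := by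
    simpa [f', polyDiff, Pi.single_apply] using hi
  set u : Vec4 := Pi.single i 1
  have hsurj : (f'.prod g').range = ⊤ := by
    rw [LinearMap.range_eq_top]
    rintro ⟨a, b⟩
    refine ⟨(a / f' u) • u + ((b - a / f' u * g' u) / g' w) • w, ?_⟩
    ext
    · simp [hw', hu]
    · simp [hgw]
  have hmap := (hf.prodMk hg).map_nhds_eq_of_surj hsurj
  have h0 : eval v X.poly = 0 := hv.2
  have h1 : eval (A v) X.poly = 0 := (hA v hv).2
  have hne : ∀ᶠ x in nhds v, x ≠ 0 := isOpen_ne.mem_nhds hv.1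
  have hev : ∀ᶠ y : ℂ × ℂ in nhds ((0 : ℂ), (0 : ℂ)), y.1 = 0 → y.2 = 0 := by
    rw [h0, h1] at hmap
    rw [← hmap, Filter.eventually_map]
    filter_upwards [hne] with x hx hx0
    exact (hA x ⟨hx, hx0⟩).2
  have hev2 : ∀ᶠ t : ℂ in nhds 0, t = 0 := by
    have hc : Filter.Tendsto (fun t : ℂ => ((0 : ℂ), t)) (nhds 0) (nhds (0, 0)) :=
      (by fun_prop : Continuous fun t : ℂ => ((0 : ℂ), t)).tendsto 0
    filter_upwards [hc.eventually hev] with t ht using ht rfl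
  have : ({0} : Set ℂ) ∈ nhds (0 : ℂ) := hev2
  exact not_isOpen_singleton (0 : ℂ) (isOpen_singleton_iff_nhds_eq_pure (0 : ℂ) |>.2
    (le_antisymm (Filter.le_pure_iff.2 this) (pure_le_nhds _)))

/-- The space `H^{2,0}(X) = H⁰(X, Ω²)` of holomorphic 2-forms on `X`. With `π` the projection of
the punctured cone to `X`, the tangent space of `X` at `π v` is `X.tangent v` modulo the line
`ℂ v`, and a 2-form `η` on `X` is the same as its pull-back `ω = π^* η` to the cone: a
family of alternating forms `ω v` on the spaces `X.tangent v` that is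
(1) horizontal: `ω v` vanishes if one argument is the radial vector `v`;
(2) invariant under the scalings `v ↦ c v`;
(3) holomorphic: locally the restriction of a holomorphic 2-form on an open subset of `ℂ⁴`. -/
def H20 : Submodule ℂ (∀ v : X.cone, X.tangent v [⋀^Fin 2]→ₗ[ℂ] ℂ) where
  carrier := {ω |
    (∀ (v : X.cone) (w : Fin 2 → X.tangent v), (w 0 : Vec4) = v → ω v w = 0) ∧
    (∀ (c : ℂ) (v v' : X.cone), (v' : Vec4) = c • (v : Vec4) →
      ∀ (w : Fin 2 → X.tangent v) (w' : Fin 2 → X.tangent v'),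
        (∀ i, (w' i : Vec4) = c • (w i : Vec4)) → ω v' w' = ω v w) ∧
    (∀ v₀ : X.cone, ∃ U : Set Vec4, IsOpen U ∧ (v₀ : Vec4) ∈ U ∧
      ∃ η : Vec4 → Vec4 [⋀^Fin 2]→ₗ[ℂ] ℂ,
        (∀ w : Fin 2 → Vec4, DifferentiableOn ℂ (fun x => η x w) U) ∧
        ∀ v : X.cone, (v : Vec4) ∈ U → ∀ w : Fin 2 → X.tangent v,
          ω v w = η v (fun i => (w i : Vec4)))}
  add_mem' := by
    rintro ω ω' ⟨h1, h2, h3⟩ ⟨h1', h2', h3'⟩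
    refine ⟨fun v w hw => by simp [h1 v w hw, h1' v w hw],
      fun c v v' hv w w' hw => by simp [h2 c v v' hv w w' hw, h2' c v v' hv w w' hw],
      fun v₀ => ?_⟩
    obtain ⟨U, hU, hv, η, hη, he⟩ := h3 v₀
    obtain ⟨U', hU', hv', η', hη', he'⟩ := h3' v₀
    refine ⟨U ∩ U', hU.inter hU', ⟨hv, hv'⟩, fun x => η x + η' x, fun w => ?_, fun v hvU w => ?_⟩
    · exact ((hη w).mono Set.inter_subset_left).add ((hη' w).mono Set.inter_subset_right)
    · simp [he v hvU.1 w, he' v hvU.2 w]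
  zero_mem' := ⟨fun _ _ _ => rfl, fun _ _ _ _ _ _ _ => rfl, fun _ =>
    ⟨Set.univ, isOpen_univ, trivial, fun _ => 0, fun _ => differentiableOn_const 0,
      fun _ _ _ => rfl⟩⟩
  smul_mem' := by
    rintro a ω ⟨h1, h2, h3⟩
    refine ⟨fun v w hw => by simp [h1 v w hw],
      fun c v v' hv w w' hw => by simp [h2 c v v' hv w w' hw], fun v₀ => ?_⟩
    obtain ⟨U, hU, hv, η, hη, he⟩ := h3 v₀
    refine ⟨U, hU, hv, fun x => a • η x, fun w => ?_, fun v hvU w => ?_⟩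
    · exact (hη w).const_smul a
    · simp [he v hvU w]

/-- The linear map `T_v → T_{A v}` induced by a linear map `A` that preserves the cone. -/
def tangentMap (A : Vec4 ≃ₗ[ℂ] Vec4) (hA : ∀ v ∈ X.cone, A v ∈ X.cone) (v : X.cone) :
    X.tangent v →ₗ[ℂ] X.tangent (A v) :=
  A.toLinearMap.restrict fun _ hw => X.map_mem_tangent A hA v.2 hw

/-- The pull-back `A^*` of holomorphic 2-forms on `X`, for an invertible linear map `A` that
preserves the cone over `X`:  `(A^* ω)_v (w₀, w₁) = ω_{A v} (A w₀, A w₁)`. -/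
def pullback (A : Vec4 ≃ₗ[ℂ] Vec4) (hA : ∀ v ∈ X.cone, A v ∈ X.cone) : X.H20 →ₗ[ℂ] X.H20 where
  toFun ω := ⟨fun v => (ω.1 ⟨A v, hA v v.2⟩).compLinearMap (X.tangentMap A hA v), by
    obtain ⟨ω, h1, h2, h3⟩ := ω
    refine ⟨fun v w hw => ?_, fun c v v' hv w w' hw => ?_, fun v₀ => ?_⟩
    · exact h1 ⟨A v, hA v v.2⟩ _ (congrArg A hw)
    · refine h2 c ⟨A v, hA v v.2⟩ ⟨A v', hA v' v'.2⟩ ?_ _ _ fun i => ?_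
      · simp [hv]
      · exact (congrArg A (hw i)).trans (map_smul A _ _)
    · obtain ⟨U, hU, hv, η, hη, he⟩ := h3 ⟨A v₀, hA v₀ v₀.2⟩
      have hAc : Differentiable ℂ (fun x : Vec4 => A x) :=
        (LinearMap.toContinuousLinearMap A.toLinearMap).differentiable
      refine ⟨A ⁻¹' U, hU.preimage hAc.continuous, hv,
        fun x => (η (A x)).compLinearMap A.toLinearMap, fun w => ?_, fun v hvU w => ?_⟩
      · exact (hη fun i => A (w i)).comp hAc.differentiableOn fun _ hx => hx
      · exact he ⟨A v, hA v v.2⟩ hvU _⟩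
  map_add' _ _ := rfl
  map_smul' _ _ := rfl

/-- `l'` and `l''` are twin lines on `X`: two disjoint lines on `X` such that there exist ten
other distinct lines on `X` each of which meets both `l'` and `l''`. -/
def AreTwinLines (l' l'' : Set P3) : Prop :=
  IsLine l' ∧ IsLine l'' ∧ l' ⊆ X.surface ∧ l'' ⊆ X.surface ∧ Disjoint l' l'' ∧
    ∃ m : Fin 10 → Set P3, Function.Injective m ∧
      ∀ i, IsLine (m i) ∧ m i ⊆ X.surface ∧ m i ≠ l' ∧ m i ≠ l'' ∧
        (m i ∩ l').Nonempty ∧ (m i ∩ l'').Nonempty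

/-- A symmetry of `X`: an automorphism of `X` that is the restriction of an automorphism of `ℙ³`.
As in the usual notation, it is recorded together with the automorphism of `ℙ³`. -/
structure Symmetry where
  /-- The automorphism of `ℙ³`. -/
  aut : Equiv.Perm P3
  aut_mem : aut ∈ AutP3
  preserves : ∀ p, aut p ∈ X.surface ↔ p ∈ X.surface

namespace Symmetry

variable {X} (τ : X.Symmetry)

/-- The symmetry as a bijection `X → X`. -/
def onSurface : Equiv.Perm X.surface := τ.aut.subtypePerm τ.preserves

/-- The fixed locus `Fix(τ, X)`, as a subset of `ℙ³`. -/
def fixX : Set P3 := Subtype.val '' {x : X.surface | τ.onSurface x = x}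

/-- The fixed locus `Fix(τ, ℙ³)`. -/
def fixP3 : Set P3 := {p | τ.aut p = p}

/-- `A` is a linear map representing the symmetry `τ`. -/
def IsLift (A : Vec4 ≃ₗ[ℂ] Vec4) : Prop := ∀ p : P3, τ.aut p = A • p

theorem IsLift.map_mem_cone {τ : X.Symmetry} {A : Vec4 ≃ₗ[ℂ] Vec4} (hA : τ.IsLift A) :
    ∀ v ∈ X.cone, A v ∈ X.cone := by
  intro v hv
  have h := (τ.preserves _).2 ((X.mk_mem_surface hv.1).2 hv)
  rw [hA] at h
  exact (X.mk_mem_surface ((map_ne_zero_iff A A.injective).2 hv.1)).1 h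

/-- The symmetry `τ` is symplectic if it acts trivially on `H^{2,0}(X)`. The pull-back of
2-forms is computed with a linear map representing `τ`, and does not depend on the choice. -/
def IsSymplectic : Prop :=
  ∀ (A : Vec4 ≃ₗ[ℂ] Vec4) (hA : τ.IsLift A), X.pullback A hA.map_mem_cone = LinearMap.id

end Symmetry

end SmoothQuartic

end

/-!
Choose coordinates `(a, b)` on `ℂ² ⊕ ℂ²` in which `l'` is `b = 0` and `l''` is `a = 0`. Since the
quartic contains both lines, its equation is `F = Φ₃₁ + Φ₂₂ + Φ₁₃` with `Φᵢⱼ` of bidegree `(i, j)`.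
Each of the two conditions is equivalent to `Φ₂₂ = 0`.

The lines in `X` that meet `l'` and `l''` are the joins of `(a, 0)` and `(0, b)` for the common
zeros `(a, b)` of the three `Φᵢⱼ`. Smoothness along `l'` makes `Φ₃₁ = 0`, which is linear in `b`,
the graph of a map `b = g a` of degree `3`. On this graph `Φ₂₂` becomes a binary form of degree
`8`, so ten lines force it to vanish, and then `Φ₂₂ = 0` because its degree `2` in `a` is less than
the degree `3` of the graph. Conversely, if `Φ₂₂ = 0`, the lines correspond to the zeros of `Φ₁₃`
on the graph, a binary form of degree `10` whose zeros are simple by smoothness.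

If `Φ₂₂ = 0`, the involution `(a, b) ↦ (a, -b)` has determinant `1` and sends `F` to `-F`, hence
changes the sign of the residue of `Ω / F`. Conversely, a projectivity with fixed locus `l' ∪ l''`
is `(a, b) ↦ (α a, β b)` with `α ≠ β`, so for all `(a, b)` the roots `z` of
`Φ₃₁ + z Φ₂₂ + z² Φ₁₃` are stable under multiplication by `β / α ≠ 1`, which forces `Φ₂₂ = 0`.
-/

noncomputable section

section Differential

variable {R : Type*} [CommRing R] {σ τ : Type*}

theorem eval_bind₁ (g : τ → MvPolynomial σ R) (f : MvPolynomial τ R) (v : σ → R) :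
    eval v (bind₁ g f) = eval (fun j => eval v (g j)) f :=
  eval₂Hom_bind₁ _ _ _ _

variable [Fintype σ]

/-- The differential at `v` of a polynomial, as a linear form; for `R = ℂ` and four variables it is
`polyDiff`. -/
def differential (f : MvPolynomial σ R) (v : σ → R) : (σ → R) →ₗ[R] R :=
  ∑ i, eval v (pderiv i f) • LinearMap.proj i

theorem differential_apply (f : MvPolynomial σ R) (v w : σ → R) :
    differential f v w = ∑ i, eval v (pderiv i f) * w i := by
  simp [differential]

theorem differential_C (c : R) (v : σ → R) : differential (C c) v = 0 := by
  ext; simp [differential_apply]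

theorem differential_add (f g : MvPolynomial σ R) (v : σ → R) :
    differential (f + g) v = differential f v + differential g v := by
  simp [differential, add_smul, Finset.sum_add_distrib]

theorem differential_sum {ι : Type*} (s : Finset ι) (f : ι → MvPolynomial σ R) (v : σ → R) :
    differential (∑ i ∈ s, f i) v = ∑ i ∈ s, differential (f i) v := by
  simp only [differential, map_sum, Finset.sum_smul]
  exact Finset.sum_comm

theorem differential_mul (f g : MvPolynomial σ R) (v : σ → R) :
    differential (f * g) v = eval v f • differential g v + eval v g • differential f v := by
  simp [differential, add_smul, mul_smul, Finset.sum_add_distrib, Finset.smul_sum]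

theorem differential_X (i : σ) (v : σ → R) : differential (X i) v = LinearMap.proj i := by
  classical
  simp [differential, pderiv_X, Pi.single_apply, apply_ite]

theorem differential_bind₁ [Fintype τ] (g : τ → MvPolynomial σ R) (f : MvPolynomial τ R)
    (v w : σ → R) : differential (bind₁ g f) v w =
      differential f (fun j => eval v (g j)) fun j => differential (g j) v w := by
  induction f using MvPolynomial.induction_on with
  | C c => simp only [bind₁_C_right, differential_C, LinearMap.zero_apply]
  | add p q hp hq => simp only [map_add, differential_add, LinearMap.add_apply, hp, hq]
  | mul_X p j hp =>
    simp only [map_mul, bind₁_X_right, differential_mul, differential_X, LinearMap.add_apply,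
      LinearMap.smul_apply, LinearMap.proj_apply, eval_X, hp, eval_bind₁]

theorem differential_apply_self {f : MvPolynomial σ R} {n : ℕ} (hf : f.IsHomogeneous n)
    (v : σ → R) : differential f v v = n * eval v f := by
  simpa [differential_apply, mul_comm] using congrArg (eval v) hf.sum_X_mul_pderiv

/-- A polynomial whose zero set has no singular point away from the origin; for a form, this is
the equation of a smooth projective hypersurface. -/
def IsNonsingular (f : MvPolynomial σ R) : Prop :=
  ∀ v, v ≠ 0 → eval v f = 0 → differential f v ≠ 0

end Differential

section RestrictLine

variable {R : Type*} [CommRing R] {σ : Type*}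

/-- The restriction of `f` to the line `t ↦ t • d + e`. -/
def restrictLine (d e : σ → R) (f : MvPolynomial σ R) : Polynomial R :=
  aeval (fun i => Polynomial.C (d i) * Polynomial.X + Polynomial.C (e i)) f

theorem eval_restrictLine (d e : σ → R) (f : MvPolynomial σ R) (t : R) :
    (restrictLine d e f).eval t = eval (t • d + e) f := by
  rw [restrictLine, ← Polynomial.coe_evalRingHom, map_aeval]
  have hcomp : (Polynomial.evalRingHom t).comp (algebraMap R (Polynomial R)) = RingHom.id R := by
    ext; simp
  rw [hcomp]
  refine congrArg (fun v => eval v f) (funext fun i => ?_)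
  simp [mul_comm t]

theorem eval_derivative_restrictLine [Fintype σ] (d e : σ → R) (f : MvPolynomial σ R) (t : R) :
    (restrictLine d e f).derivative.eval t = differential f (t • d + e) d := by
  induction f using MvPolynomial.induction_on with
  | C c => simp [restrictLine, differential_C]
  | add p q hp hq =>
    rw [differential_add, LinearMap.add_apply, ← hp, ← hq]
    simp [restrictLine]
  | mul_X p i hp =>
    have hX : restrictLine d e (X i) = Polynomial.C (d i) * Polynomial.X + Polynomial.C (e i) :=
      aeval_X _ _
    have hmul : restrictLine d e (p * X i) = restrictLine d e p * restrictLine d e (X i) :=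
      map_mul _ _ _
    rw [differential_mul, differential_X, hmul, hX]
    simp only [Polynomial.derivative_mul, Polynomial.derivative_add, Polynomial.derivative_X,
      Polynomial.derivative_C, Polynomial.eval_add, Polynomial.eval_mul, Polynomial.eval_C,
      Polynomial.eval_X, Polynomial.eval_one, Polynomial.eval_zero,
      eval_restrictLine, hp, eval_X, LinearMap.add_apply, LinearMap.smul_apply,
      LinearMap.proj_apply, smul_eq_mul, Pi.add_apply, Pi.smul_apply]
    ring

theorem coeff_prod_sum_of_natDegree_le {ι : Type*} (s : Finset ι) (f : ι → Polynomial R)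
    (n : ι → ℕ) (h : ∀ i ∈ s, (f i).natDegree ≤ n i) :
    (∏ i ∈ s, f i).coeff (∑ i ∈ s, n i) = ∏ i ∈ s, (f i).coeff (n i) := by
  classical
  induction s using Finset.induction_on with
  | empty => simp
  | insert i s hi ih =>
    rw [Finset.forall_mem_insert] at h
    rw [Finset.prod_insert hi, Finset.sum_insert hi, Finset.prod_insert hi, ← ih h.2]
    exact Polynomial.coeff_mul_add_eq_of_natDegree_le h.1
      ((Polynomial.natDegree_prod_le _ _).trans (Finset.sum_le_sum h.2))

theorem natDegree_restrictLine_le {f : MvPolynomial σ R} {n : ℕ} (hf : f.IsHomogeneous n)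
    (d e : σ → R) : (restrictLine d e f).natDegree ≤ n :=
  (aeval_natDegree_le f hf.totalDegree_le _ fun _ =>
    Polynomial.natDegree_linear_le).trans_eq (mul_one n)

theorem coeff_restrictLine {f : MvPolynomial σ R} {n : ℕ} (hf : f.IsHomogeneous n)
    (d e : σ → R) : (restrictLine d e f).coeff n = eval d f := by
  induction hf using IsWeightedHomogeneous.induction_on with
  | zero => simp only [restrictLine, map_zero, Polynomial.coeff_zero]
  | add p q _ _ hp hq =>
    rw [restrictLine, map_add, map_add, Polynomial.coeff_add]
    exact congrArg₂ _ hp hq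
  | monomial k r hk =>
    have hk' : ∑ i ∈ k.support, k i * 1 = n := by
      rw [← hk]; simp [Finsupp.weight_apply, Finsupp.sum]
    rw [restrictLine, aeval_monomial, eval_monomial, ← Polynomial.C_eq_algebraMap,
      Polynomial.coeff_C_mul, Finsupp.prod, Finsupp.prod, ← hk', coeff_prod_sum_of_natDegree_le]
    · refine congrArg (r * ·) (Finset.prod_congr rfl fun i _ => ?_)
      rw [Polynomial.coeff_pow_of_natDegree_le Polynomial.natDegree_linear_le]
      simp
    · exact fun i _ => Polynomial.natDegree_pow_le_of_le _ Polynomial.natDegree_linear_le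

end RestrictLine

section WeightedHomogeneous

variable {R : Type*} [CommRing R] {σ τ M : Type*} [AddCommMonoid M] {w : σ → M} {n : M}
  {f : MvPolynomial σ R}

theorem eval_mul_of_isWeightedHomogeneous (hf : IsWeightedHomogeneous w f n)
    (χ : Multiplicative M →* R) (v : σ → R) :
    eval (fun i => χ (.ofAdd (w i)) * v i) f = χ (.ofAdd n) * eval v f := by
  induction hf using IsWeightedHomogeneous.induction_on with
  | zero => simp only [map_zero, mul_zero]
  | add p q _ _ hp hq => simp only [map_add, mul_add, hp, hq]
  | monomial d r hd =>
    have hχ : (d.prod fun i k => χ (.ofAdd (w i)) ^ k) = χ (.ofAdd n) := by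
      simp [← hd, Finsupp.weight_apply, Finsupp.sum, Finsupp.prod, ofAdd_sum, ofAdd_nsmul]
    simp only [eval_monomial, mul_pow, Finsupp.prod_mul, hχ]
    ring

theorem isHomogeneous_bind₁_of_isWeightedHomogeneous (hf : IsWeightedHomogeneous w f n)
    (φ : M →+ ℕ) {g : σ → MvPolynomial τ R} (hg : ∀ i, (g i).IsHomogeneous (φ (w i))) :
    (bind₁ g f).IsHomogeneous (φ n) := by
  induction hf using IsWeightedHomogeneous.induction_on with
  | zero => simpa using isHomogeneous_zero τ R (φ n)
  | add p q _ _ hp hq => simpa using hp.add hq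
  | monomial d r hd =>
    have hφ : ∑ i ∈ d.support, φ (w i) * d i = φ n := by
      simp [← hd, Finsupp.weight_apply, Finsupp.sum, mul_comm]
    rw [bind₁_monomial, ← hφ]
    refine .C_mul (.prod _ _ _ fun i _ => (hg i).pow _) r

theorem eval_smul {f : MvPolynomial σ R} {n : ℕ} (hf : f.IsHomogeneous n) (c : R) (v : σ → R) :
    eval (c • v) f = c ^ n * eval v f := by
  simpa using! eval_mul_of_isWeightedHomogeneous hf (powersHom R c) v

end WeightedHomogeneous

section Plane

variable {K V : Type*} [Field K] [AddCommGroup V] [Module K V]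

theorem exists_eq_smul_add_smul (hV : Module.finrank K V = 2) {d e : V}
    (hde : LinearIndependent K ![d, e]) (v : V) : ∃ s t : K, v = s • d + t • e := by
  have htop := hde.span_eq_top_of_card_eq_finrank (by simp [hV])
  rw [Matrix.range_cons_cons_empty] at htop
  obtain ⟨s, t, h⟩ := Submodule.mem_span_pair.1 (htop ▸ Submodule.mem_top (x := v))
  exact ⟨s, t, h.symm⟩

theorem exists_eq_smul_of_apply_eq_zero (hV : Module.finrank K V = 2) {φ : V →ₗ[K] K}
    (hφ : φ ≠ 0) {v w : V} (hv : v ≠ 0) (hφv : φ v = 0) (hφw : φ w = 0) : ∃ c : K, w = c • v := by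
  by_contra! h
  have hvw : LinearIndependent K ![v, w] :=
    (LinearIndependent.pair_iff' hv).2 fun c hc => h c hc.symm
  refine hφ (LinearMap.ext fun u => ?_)
  obtain ⟨s, t, rfl⟩ := exists_eq_smul_add_smul hV hvw u
  simp [hφv, hφw]

theorem exists_eq_smul_of_common_zero (hV : Module.finrank K V = 2) {φ ψ : V →ₗ[K] K}
    (hφ : φ ≠ 0) {v : V} (hv : v ≠ 0) (hφv : φ v = 0) (hψv : ψ v = 0) : ∃ c : K, ψ = c • φ := by
  obtain ⟨e, he⟩ := DFunLike.ne_iff.1 hφ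
  have hve : LinearIndependent K ![v, e] :=
    (LinearIndependent.pair_iff' hv).2 fun c hc => he (by simp [← hc, hφv])
  refine ⟨ψ e / φ e, LinearMap.ext fun u => ?_⟩
  obtain ⟨s, t, rfl⟩ := exists_eq_smul_add_smul hV hve u
  have he' : φ e ≠ 0 := he
  simp only [map_add, map_smul, hφv, hψv, LinearMap.smul_apply, smul_eq_mul, mul_zero, zero_add]
  field_simp

end Plane

section BinaryForm

variable {K : Type*} [Field K] {σ : Type*}

theorem exists_ne_zero_eval_ne_zero [Infinite K] [Nonempty σ] {f : MvPolynomial σ K}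
    (hf : f ≠ 0) : ∃ d, d ≠ 0 ∧ eval d f ≠ 0 := by
  obtain ⟨i⟩ := ‹Nonempty σ›
  obtain ⟨d, hd⟩ : ∃ d, eval d (f * X i) ≠ 0 := by
    by_contra! h
    exact mul_ne_zero hf (X_ne_zero i) (MvPolynomial.funext fun d => by simpa using h d)
  rw [map_mul, eval_X] at hd
  exact ⟨d, fun h => right_ne_zero_of_mul hd (congrFun h i), left_ne_zero_of_mul hd⟩

variable {f : MvPolynomial (Fin 2) K} {n : ℕ} {d e : Fin 2 → K}

theorem eq_zero_of_restrictLine_eq_zero [Infinite K] (hf : f.IsHomogeneous n)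
    (hde : LinearIndependent K ![d, e]) (h : restrictLine d e f = 0) : f = 0 := by
  refine MvPolynomial.funext fun v => ?_
  obtain ⟨s, t, rfl⟩ := exists_eq_smul_add_smul (by simp) hde v
  rw [map_zero]
  by_cases ht : t = 0
  · rw [ht, zero_smul, add_zero, eval_smul hf, ← coeff_restrictLine hf d e, h,
      Polynomial.coeff_zero, mul_zero]
  · have hsplit : s • d + t • e = t • ((s / t) • d + e) := by
      rw [smul_add, smul_smul, mul_div_cancel₀ s ht]
    rw [hsplit, eval_smul hf, ← eval_restrictLine, h, Polynomial.eval_zero, mul_zero]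

theorem exists_eq_smul_add_of_eval_ne_zero (hf : f.IsHomogeneous n)
    (hde : LinearIndependent K ![d, e]) (hd : eval d f ≠ 0) {v : Fin 2 → K} (hv : v ≠ 0)
    (hfv : eval v f = 0) : ∃ s t : K, t ≠ 0 ∧ v = t • (s • d + e) := by
  obtain ⟨s, t, rfl⟩ := exists_eq_smul_add_smul (by simp) hde v
  have ht : t ≠ 0 := by
    rintro rfl
    rw [zero_smul, add_zero] at hv hfv
    rw [eval_smul hf] at hfv
    exact (mul_ne_zero (pow_ne_zero n (left_ne_zero_of_smul hv)) hd) hfv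
  exact ⟨s / t, t, ht, by rw [smul_add, smul_smul, mul_div_cancel₀ s ht]⟩

theorem eq_zero_of_lt_card_zeros [Infinite K] (hf : f.IsHomogeneous n) {ι : Type*} [Fintype ι]
    {a : ι → Fin 2 → K} (ha0 : ∀ i, a i ≠ 0)
    (ha : Pairwise fun i j => LinearIndependent K ![a i, a j]) (hfa : ∀ i, eval (a i) f = 0)
    (hn : n < Fintype.card ι) : f = 0 := by
  by_contra hf0
  obtain ⟨d, hd0, hd⟩ := exists_ne_zero_eval_ne_zero hf0
  obtain ⟨e, hde⟩ := exists_linearIndependent_pair_of_one_lt_finrank (R := K) (by simp) hd0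
  choose s t ht hst using fun i => exists_eq_smul_add_of_eval_ne_zero hf hde hd (ha0 i) (hfa i)
  have hs : Function.Injective s := by
    intro i j hij
    by_contra hne
    refine (LinearIndependent.pair_iff' (ha0 i)).1 (ha hne) (t j / t i) ?_
    rw [hst i, hst j, hij, smul_smul, div_mul_cancel₀ _ (ht i)]
  have hroot : ∀ i, (restrictLine d e f).eval (s i) = 0 := fun i => by
    have h := hfa i
    rw [hst i, eval_smul hf] at h
    rw [eval_restrictLine]
    exact (mul_eq_zero.1 h).resolve_left (pow_ne_zero n (ht i))
  have hzero := Polynomial.eq_zero_of_natDegree_lt_card_of_eval_eq_zero _ hs hroot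
    ((natDegree_restrictLine_le hf d e).trans_lt hn)
  exact hd (by rw [← coeff_restrictLine hf d e, hzero, Polynomial.coeff_zero])

theorem natDegree_restrictLine (hf : f.IsHomogeneous n) (hd : eval d f ≠ 0) :
    (restrictLine d e f).natDegree = n :=
  Polynomial.natDegree_eq_of_le_of_coeff_ne_zero (natDegree_restrictLine_le hf d e)
    (by rwa [coeff_restrictLine hf])

theorem smul_add_ne_zero (hde : LinearIndependent K ![d, e]) (t : K) : t • d + e ≠ 0 := fun h =>
  one_ne_zero (LinearIndependent.pair_iff.1 hde t 1 (by rwa [one_smul])).2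

theorem separable_restrictLine [IsAlgClosed K] (hf : f.IsHomogeneous n) (hns : IsNonsingular f)
    (hde : LinearIndependent K ![d, e]) : (restrictLine d e f).Separable := by
  rw [Polynomial.Separable, Polynomial.isCoprime_iff_aeval_ne_zero_of_isAlgClosed K K]
  intro t
  simp only [Polynomial.coe_aeval_eq_eval, eval_restrictLine, eval_derivative_restrictLine]
  by_contra! h
  have hself : differential f (t • d + e) (t • d + e) = 0 := by
    rw [differential_apply_self hf, h.1, mul_zero]
  rw [map_add, map_smul, h.2, smul_zero, zero_add] at hself
  refine hns _ (smul_add_ne_zero hde t) h.1 (LinearMap.ext fun v => ?_)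
  obtain ⟨x, y, rfl⟩ := exists_eq_smul_add_smul (by simp) hde v
  rw [map_add, map_smul, map_smul, h.2, hself, smul_zero, smul_zero, add_zero, LinearMap.zero_apply]

theorem exists_zeros_of_isNonsingular [IsAlgClosed K] (hf : f.IsHomogeneous n)
    (hns : IsNonsingular f) : ∃ a : Fin n → Fin 2 → K, (∀ i, a i ≠ 0) ∧ (∀ i, eval (a i) f = 0) ∧
      Pairwise fun i j => LinearIndependent K ![a i, a j] := by
  have hf0 : f ≠ 0 := by
    rintro rfl
    exact hns 1 one_ne_zero (map_zero _) (by simp [differential])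
  obtain ⟨d, hd0, hd⟩ := exists_ne_zero_eval_ne_zero hf0
  obtain ⟨e, hde⟩ := exists_linearIndependent_pair_of_one_lt_finrank (R := K) (by simp) hd0
  have hcard : Fintype.card ((restrictLine d e f).rootSet K) = n := by
    rw [Polynomial.card_rootSet_eq_natDegree (separable_restrictLine hf hns hde)
      (IsAlgClosed.splits _), natDegree_restrictLine hf hd]
  let s := (Fintype.equivFinOfCardEq hcard).symm
  refine ⟨fun i => (s i : K) • d + e, fun i => smul_add_ne_zero hde _, fun i => ?_,
    fun i j hij => ?_⟩
  · rw [← eval_restrictLine]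
    simpa using Polynomial.aeval_eq_zero_of_mem_rootSet (s i).2
  · have hs : (s i : K) ≠ s j := fun h => hij (s.injective (Subtype.ext h))
    have h := (LinearIndependent.pair_add_smul_add_smul_iff (x := d) (y := e)
      (s i : K) 1 (s j) 1).2 ⟨hde, by simpa using hs⟩
    simpa only [one_smul] using h

theorem exists_zero_of_binaryForm [IsAlgClosed K] (hf : f.IsHomogeneous n) (hn : n ≠ 0) :
    ∃ a, a ≠ 0 ∧ eval a f = 0 := by
  obtain ⟨e, hde⟩ := exists_linearIndependent_pair_of_one_lt_finrank (R := K)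
    (x := (1 : Fin 2 → K)) (by simp) one_ne_zero
  by_cases hd : eval 1 f = 0
  · exact ⟨1, one_ne_zero, hd⟩
  · obtain ⟨t, ht⟩ := IsAlgClosed.exists_root (restrictLine 1 e f) (by
      rw [Polynomial.degree_eq_natDegree ?_, natDegree_restrictLine hf hd]
      · exact_mod_cast hn
      · intro h
        exact hd (by rw [← coeff_restrictLine hf 1 e, h, Polynomial.coeff_zero]))
    exact ⟨t • 1 + e, smul_add_ne_zero hde t, by rwa [← eval_restrictLine]⟩

end BinaryForm

section Bihomogeneous

variable {R : Type*} [CommRing R] {σ τ : Type*} {m n : ℕ}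

variable (σ τ) in
/-- The bidegrees of the variables of a polynomial in two groups of variables. -/
def bidegree : σ ⊕ τ → ℕ × ℕ := Sum.elim (fun _ => (1, 0)) fun _ => (0, 1)

/-- A polynomial in two groups of variables that is homogeneous of degree `m` in the first group
and of degree `n` in the second. -/
abbrev IsBihomogeneous (Ψ : MvPolynomial (σ ⊕ τ) R) (m n : ℕ) : Prop :=
  IsWeightedHomogeneous (bidegree σ τ) Ψ (m, n)

/-- The part of bidegree `(m, n)` of a polynomial in two groups of variables. -/
def bihomogeneousComponent (m n : ℕ) (Φ : MvPolynomial (σ ⊕ τ) R) : MvPolynomial (σ ⊕ τ) R :=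
  weightedHomogeneousComponent (bidegree σ τ) (m, n) Φ

theorem isBihomogeneous_bihomogeneousComponent (m n : ℕ) (Φ : MvPolynomial (σ ⊕ τ) R) :
    IsBihomogeneous (bihomogeneousComponent m n Φ) m n :=
  weightedHomogeneousComponent_isWeightedHomogeneous _ _

theorem weight_bidegree (x : σ →₀ ℕ) (y : τ →₀ ℕ) :
    Finsupp.weight (bidegree σ τ) (x.sumElim y) = (x.degree, y.degree) := by
  simp [Finsupp.weight_apply, bidegree, Finsupp.sum, Finsupp.degree_apply, Prod.ext_iff,
    Prod.fst_sum, Prod.snd_sum]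

theorem sum_bihomogeneousComponent {Φ : MvPolynomial (σ ⊕ τ) R} {N : ℕ}
    (hΦ : Φ.IsHomogeneous N) :
    ∑ x ∈ Finset.HasAntidiagonal.antidiagonal N, bihomogeneousComponent x.1 x.2 Φ = Φ := by
  refine MvPolynomial.ext _ _ fun d => ?_
  obtain ⟨⟨x, y⟩, rfl⟩ := Finsupp.sumFinsuppEquivProdFinsupp.symm.surjective d
  simp only [bihomogeneousComponent, coeff_sum, coeff_weightedHomogeneousComponent, Prod.mk.eta,
    Finset.sum_ite_eq, ite_eq_left_iff, Finsupp.sumFinsuppEquivProdFinsupp_symm_apply,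
    weight_bidegree, Finset.HasAntidiagonal.mem_antidiagonal]
  refine fun hdeg => by_contra fun hcoeff => hdeg ?_
  rw [← hΦ (Ne.symm hcoeff)]
  simp [Finsupp.weight_apply, Finsupp.sum, Finsupp.degree_apply]

theorem eval_sumElim_smul {Ψ : MvPolynomial (σ ⊕ τ) R} (hΨ : IsBihomogeneous Ψ m n) (s t : R)
    (a : σ → R) (b : τ → R) :
    eval (Sum.elim (s • a) (t • b)) Ψ = s ^ m * t ^ n * eval (Sum.elim a b) Ψ := by
  let χ : Multiplicative (ℕ × ℕ) →* R :=
    { toFun x := s ^ x.toAdd.1 * t ^ x.toAdd.2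
      map_one' := by simp
      map_mul' x y := by simp only [toAdd_mul, Prod.fst_add, Prod.snd_add, pow_add]; ring }
  have hχ : Sum.elim (s • a) (t • b) =
      fun i => χ (.ofAdd (bidegree σ τ i)) * Sum.elim a b i := by
    ext (i | i) <;> simp [χ, bidegree]
  rw [hχ, eval_mul_of_isWeightedHomogeneous hΨ χ]
  rfl

theorem exists_eval_eq_sum_of_isBihomogeneous {Ψ : MvPolynomial (σ ⊕ Fin 2) R}
    (hΨ : IsBihomogeneous Ψ m n) : ∃ c : ℕ → MvPolynomial σ R, (∀ k, (c k).IsHomogeneous m) ∧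
      ∀ a b, eval (Sum.elim a b) Ψ =
        ∑ k ∈ Finset.range (n + 1), eval a (c k) * (b 0 ^ k * b 1 ^ (n - k)) := by
  induction hΨ using IsWeightedHomogeneous.induction_on with
  | zero => exact ⟨0, fun _ => isHomogeneous_zero _ _ _, by simp⟩
  | add p q _ _ hp hq =>
    obtain ⟨c, hc, hpc⟩ := hp
    obtain ⟨d, hd, hqd⟩ := hq
    exact ⟨c + d, fun k => (hc k).add (hd k), fun a b => by
      simp [hpc, hqd, add_mul, Finset.sum_add_distrib]⟩
  | monomial d r hd =>
    obtain ⟨⟨x, y⟩, rfl⟩ := Finsupp.sumFinsuppEquivProdFinsupp.symm.surjective d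
    simp only [Finsupp.sumFinsuppEquivProdFinsupp_symm_apply, weight_bidegree,
      Prod.mk.injEq] at hd ⊢
    obtain ⟨rfl, rfl⟩ := hd
    have hy : y.degree = y 0 + y 1 := by
      rw [Finsupp.degree_eq_sum, Fin.sum_univ_two]
    refine ⟨fun k => if k = y 0 then monomial x r else 0, fun k => ?_, fun a b => ?_⟩
    · beta_reduce
      split_ifs
      exacts [isHomogeneous_monomial r rfl, isHomogeneous_zero _ _ _]
    · rw [Finset.sum_eq_single_of_mem (y 0) (Finset.mem_range.2 (by lia))
        fun k _ hk => by simp only [if_neg hk, map_zero, zero_mul]]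
      simp [eval_monomial, Finsupp.prod_sumElim, Function.comp_def, Finsupp.prod_fintype, hy,
        mul_assoc]

end Bihomogeneous

section BihomogeneousDifferential

variable {R : Type*} [CommRing R] {σ τ : Type*} [Fintype σ] [Fintype τ] {m n : ℕ}
  {Ψ : MvPolynomial (σ ⊕ τ) R}

theorem differential_sumElim_smul (hΨ : IsBihomogeneous Ψ (m + 1) (n + 1)) (s t : R)
    (a ξ : σ → R) (b η : τ → R) : differential Ψ (Sum.elim (s • a) (t • b)) (Sum.elim ξ η) =
      s ^ m * t ^ n * differential Ψ (Sum.elim a b) (Sum.elim (t • ξ) (s • η)) := by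
  have hl (i : σ) : IsBihomogeneous (pderiv (.inl i) Ψ) m (n + 1) := hΨ.pderiv rfl
  have hr (j : τ) : IsBihomogeneous (pderiv (.inr j) Ψ) (m + 1) n := hΨ.pderiv rfl
  simp only [differential_apply, Fintype.sum_sum_type, Sum.elim_inl, Sum.elim_inr,
    eval_sumElim_smul (hl _), eval_sumElim_smul (hr _), Pi.smul_apply, smul_eq_mul, mul_add,
    Finset.mul_sum]
  congr 1 <;> exact Finset.sum_congr rfl fun i _ => by ring

theorem differential_sumElim_zero_self (hΨ : IsBihomogeneous Ψ m n) (a : σ → R) (b : τ → R) :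
    differential Ψ (Sum.elim a b) (Sum.elim 0 b) = n * eval (Sum.elim a b) Ψ := by
  have hsnd : IsWeightedHomogeneous (Sum.elim (fun _ => 0) fun _ => 1) Ψ n := fun d hd => by
    refine Eq.trans ?_ (congrArg Prod.snd (hΨ hd))
    simp only [Finsupp.weight_apply, Finsupp.sum, Prod.snd_sum]
    exact Finset.sum_congr rfl fun i _ => by cases i <;> rfl
  have h := congrArg (eval (Sum.elim a b)) hsnd.sum_weight_X_mul_pderiv
  simpa [differential_apply, mul_comm] using h

theorem differential_sumElim_zero_right (hΨ : IsBihomogeneous Ψ (m + 1) 1) (a ξ : σ → R)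
    (η : τ → R) : differential Ψ (Sum.elim a 0) (Sum.elim ξ η) = eval (Sum.elim a η) Ψ := by
  simpa [differential_sumElim_zero_self hΨ] using
    differential_sumElim_smul (n := 0) hΨ 1 0 a ξ η η

theorem differential_sumElim_zero_left (hΨ : IsBihomogeneous Ψ (m + 1) 1) (a : σ → R)
    (b η : τ → R) : differential Ψ (Sum.elim a b) (Sum.elim 0 η) = eval (Sum.elim a η) Ψ := by
  rw [← differential_sumElim_zero_right hΨ a 0 η]
  simpa using (differential_sumElim_smul (n := 0) hΨ 1 0 a 0 b η).symm

theorem differential_sumElim_zero_right_eq_zero (hΨ : IsBihomogeneous Ψ (m + 1) (n + 2))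
    (a : σ → R) : differential Ψ (Sum.elim a 0) = 0 := by
  refine LinearMap.ext fun v => ?_
  rw [← Sum.elim_comp_inl_inr v]
  simpa using differential_sumElim_smul hΨ 1 0 a (v ∘ Sum.inl) 0 (v ∘ Sum.inr)

theorem exists_eval_bihomogeneousComponent_ne_zero {Φ : MvPolynomial (σ ⊕ τ) R} {N : ℕ}
    (hΦ : ∑ x ∈ Finset.HasAntidiagonal.antidiagonal N,
      bihomogeneousComponent (x.1 + 1) (x.2 + 1) Φ = Φ)
    (hns : IsNonsingular Φ) {a : σ → R} (ha : a ≠ 0) :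
    ∃ b, eval (Sum.elim a b) (bihomogeneousComponent (N + 1) 1 Φ) ≠ 0 := by
  have hzero {m n : ℕ} : eval (Sum.elim a 0) (bihomogeneousComponent m (n + 1) Φ) = 0 := by
    simpa using eval_sumElim_smul (isBihomogeneous_bihomogeneousComponent m (n + 1) Φ) 1 0 a 0
  have hdiff : differential Φ (Sum.elim a 0) =
      differential (bihomogeneousComponent (N + 1) 1 Φ) (Sum.elim a 0) := by
    rw [← hΦ, differential_sum, hΦ]
    refine Finset.sum_eq_single_of_mem (N, 0) (by simp) ?_
    rintro ⟨i, j⟩ hij hne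
    obtain _ | j := j
    · exact absurd (by simpa using hij) hne
    · exact differential_sumElim_zero_right_eq_zero (isBihomogeneous_bihomogeneousComponent _ _ _) a
  by_contra! h
  refine hns (Sum.elim a 0) (fun h0 => ha (congrArg (· ∘ Sum.inl) h0)) ?_ ?_
  · rw [← hΦ, map_sum]
    exact Finset.sum_eq_zero fun x _ => hzero
  · refine LinearMap.ext fun v => ?_
    rw [hdiff, ← Sum.elim_comp_inl_inr v, differential_sumElim_zero_right
      (isBihomogeneous_bihomogeneousComponent _ _ _), h, LinearMap.zero_apply]

end BihomogeneousDifferential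

section Graph

variable {R : Type*} [CommRing R] {σ τ : Type*}

/-- The restriction of a polynomial in two groups of variables to the graph of the polynomial map
`g` from the first group to the second. -/
def restrictGraph (g : τ → MvPolynomial σ R) (Ψ : MvPolynomial (σ ⊕ τ) R) : MvPolynomial σ R :=
  bind₁ (Sum.elim X g) Ψ

theorem eval_restrictGraph (g : τ → MvPolynomial σ R) (Ψ : MvPolynomial (σ ⊕ τ) R) (a : σ → R) :
    eval a (restrictGraph g Ψ) = eval (Sum.elim a fun j => eval a (g j)) Ψ := by
  have hgraph : (fun i => eval a (Sum.elim X g i)) = Sum.elim a fun j => eval a (g j) := by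
    ext (i | j) <;> simp
  rw [← hgraph]
  exact eval_bind₁ _ _ _

theorem isHomogeneous_restrictGraph {g : τ → MvPolynomial σ R} {d : ℕ}
    (hg : ∀ j, (g j).IsHomogeneous d) {Ψ : MvPolynomial (σ ⊕ τ) R} {m n : ℕ}
    (hΨ : IsBihomogeneous Ψ m n) : (restrictGraph g Ψ).IsHomogeneous (m + d * n) := by
  refine isHomogeneous_bind₁_of_isWeightedHomogeneous hΨ
    (AddMonoidHom.fst ℕ ℕ + d • AddMonoidHom.snd ℕ ℕ) ?_
  rintro (i | j)
  · simpa [bidegree] using isHomogeneous_X R i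
  · simpa [bidegree] using hg j

theorem differential_restrictGraph [Fintype σ] [Fintype τ] (g : τ → MvPolynomial σ R)
    (Ψ : MvPolynomial (σ ⊕ τ) R) (a ξ : σ → R) : differential (restrictGraph g Ψ) a ξ =
      differential Ψ (Sum.elim a fun j => eval a (g j))
        (Sum.elim ξ fun j => differential (g j) a ξ) := by
  rw [restrictGraph, differential_bind₁]
  congr 2
  · ext (i | j) <;> simp
  · ext (i | j) <;> simp [differential_X]

end Graph

section Coprime

variable {K : Type*} [Field K]

theorem eq_zero_of_sum_mul_pow_mul_pow_eq_zero {P Q : Polynomial K} (hPQ : IsCoprime P Q)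
    {u : ℕ → Polynomial K} (hu : ∀ k, (u k).degree < P.degree) {n : ℕ}
    (h : ∑ k ∈ Finset.range (n + 1), u k * (Q ^ k * P ^ (n - k)) = 0) {k : ℕ} (hk : k ≤ n) :
    u k = 0 := by
  induction n with
  | zero => simpa [Nat.le_zero.1 hk] using h
  | succ n ih =>
    have hfactor : ∑ k ∈ Finset.range (n + 1), u k * (Q ^ k * P ^ (n + 1 - k)) =
        P * ∑ k ∈ Finset.range (n + 1), u k * (Q ^ k * P ^ (n - k)) := by
      rw [Finset.mul_sum]
      refine Finset.sum_congr rfl fun k hk => ?_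
      rw [Nat.succ_sub (Finset.mem_range_succ_iff.1 hk), pow_succ]
      ring
    rw [Finset.sum_range_succ, hfactor, Nat.sub_self, pow_zero, mul_one] at h
    have hdvd : P ∣ u (n + 1) * Q ^ (n + 1) :=
      (dvd_add_right (dvd_mul_right _ _)).1 (h ▸ dvd_zero P)
    have hlast : u (n + 1) = 0 :=
      Polynomial.eq_zero_of_dvd_of_degree_lt (hPQ.pow_right.dvd_of_dvd_mul_right hdvd) (hu _)
    rcases hk.eq_or_lt with rfl | hlt
    · exact hlast
    · have hP : P ≠ 0 := Polynomial.ne_zero_of_degree_gt (hu 0)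
      rw [hlast, zero_mul, add_zero] at h
      exact ih ((mul_eq_zero.1 h).resolve_left hP) (Nat.lt_succ_iff.1 hlt)

variable [IsAlgClosed K] {d : ℕ} {g : Fin 2 → MvPolynomial (Fin 2) K}

theorem exists_eval_one_ne_zero (hg : ∀ j, (g j).IsHomogeneous d) (hd : d ≠ 0)
    (hg0 : ∀ a, a ≠ 0 → (fun j => eval a (g j)) ≠ 0) : ∃ a, a ≠ 0 ∧ eval a (g 1) ≠ 0 := by
  refine exists_ne_zero_eval_ne_zero fun h => ?_
  obtain ⟨a, ha, ha0⟩ := exists_zero_of_binaryForm (hg 0) hd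
  refine hg0 a ha (funext fun j => ?_)
  fin_cases j
  exacts [ha0, by simp [h]]

theorem isCoprime_restrictLine (hg0 : ∀ a, a ≠ 0 → (fun j => eval a (g j)) ≠ 0)
    {v e : Fin 2 → K} (hve : LinearIndependent K ![v, e]) :
    IsCoprime (restrictLine v e (g 1)) (restrictLine v e (g 0)) := by
  rw [Polynomial.isCoprime_iff_aeval_ne_zero_of_isAlgClosed K K]
  intro t
  by_contra! h
  simp only [Polynomial.coe_aeval_eq_eval, eval_restrictLine] at h
  refine hg0 _ (smul_add_ne_zero hve t) (funext fun j => ?_)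
  fin_cases j
  exacts [h.2, h.1]

theorem eq_zero_of_restrictGraph_eq_zero {m n : ℕ} (hmd : m < d)
    (hg : ∀ j, (g j).IsHomogeneous d) (hg0 : ∀ a, a ≠ 0 → (fun j => eval a (g j)) ≠ 0)
    {Ψ : MvPolynomial (Fin 2 ⊕ Fin 2) K} (hΨ : IsBihomogeneous Ψ m n)
    (h : restrictGraph g Ψ = 0) : Ψ = 0 := by
  obtain ⟨c, hc, hΨc⟩ := exists_eval_eq_sum_of_isBihomogeneous hΨ
  obtain ⟨v, hv0, hv⟩ := exists_eval_one_ne_zero hg (by lia) hg0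
  obtain ⟨e, hve⟩ := exists_linearIndependent_pair_of_one_lt_finrank (R := K) (by simp) hv0
  have hsum : ∑ k ∈ Finset.range (n + 1), restrictLine v e (c k) *
      (restrictLine v e (g 0) ^ k * restrictLine v e (g 1) ^ (n - k)) = 0 := by
    refine Polynomial.funext fun t => ?_
    have heval := eval_restrictGraph g Ψ (t • v + e)
    rw [h, map_zero, hΨc] at heval
    simpa [Polynomial.eval_finsetSum, eval_restrictLine] using heval.symm
  have hdegree (k : ℕ) : (restrictLine v e (c k)).degree < (restrictLine v e (g 1)).degree := by
    refine Polynomial.degree_lt_degree ?_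
    rw [natDegree_restrictLine (hg 1) hv]
    exact (natDegree_restrictLine_le (hc k) v e).trans_lt hmd
  have hc0 {k : ℕ} (hk : k ≤ n) : c k = 0 := eq_zero_of_restrictLine_eq_zero (hc k) hve
    (eq_zero_of_sum_mul_pow_mul_pow_eq_zero (isCoprime_restrictLine hg0 hve) hdegree hsum hk)
  refine MvPolynomial.funext fun x => ?_
  rw [← Sum.elim_comp_inl_inr x, hΨc, map_zero]
  refine Finset.sum_eq_zero fun k hk => ?_
  rw [hc0 (Finset.mem_range_succ_iff.1 hk), map_zero, zero_mul]

end Coprime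

section CrossingMap

theorem exists_eval_eq_sub_of_isBihomogeneous {R σ : Type*} [CommRing R]
    {Ψ : MvPolynomial (σ ⊕ Fin 2) R} {n : ℕ} (hΨ : IsBihomogeneous Ψ n 1) :
    ∃ g : Fin 2 → MvPolynomial σ R, (∀ j, (g j).IsHomogeneous n) ∧
      ∀ a b, eval (Sum.elim a b) Ψ = eval a (g 0) * b 1 - eval a (g 1) * b 0 := by
  obtain ⟨c, hc, hΨc⟩ := exists_eval_eq_sum_of_isBihomogeneous hΨ
  refine ⟨![c 0, -c 1], fun j => ?_, fun a b => ?_⟩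
  · fin_cases j
    exacts [hc 0, (hc 1).neg]
  · simp [hΨc, Finset.sum_range_succ]

theorem exists_eq_smul_of_mul_sub_mul_eq_zero {K : Type*} [Field K] {v w : Fin 2 → K} (hv : v ≠ 0)
    (h : v 0 * w 1 - v 1 * w 0 = 0) : ∃ c : K, w = c • v := by
  refine exists_eq_smul_of_apply_eq_zero (by simp)
    (φ := v 0 • LinearMap.proj 1 - v 1 • LinearMap.proj 0)
    (fun hφ => hv ?_) hv (by simp [mul_comm]) (by simpa using h)
  have h0 := LinearMap.congr_fun hφ ![0, 1]
  have h1 := LinearMap.congr_fun hφ ![1, 0]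
  ext j
  fin_cases j
  · simpa using h0
  · simpa using h1

end CrossingMap

section Transversality

variable {K : Type*} [Field K] {σ : Type*} [Fintype σ] {m p q : ℕ}
  {h f : MvPolynomial (σ ⊕ Fin 2) K} {g : Fin 2 → MvPolynomial σ K} {a : σ → K}

theorem exists_differential_eq_smul (hh : IsBihomogeneous h (m + 1) 1)
    (hf : IsBihomogeneous f p q) (hgh : restrictGraph g h = 0)
    (hga : (fun j => eval a (g j)) ≠ 0) (hha : ∃ b, eval (Sum.elim a b) h ≠ 0)
    (hfa : eval a (restrictGraph g f) = 0) (hdf : differential (restrictGraph g f) a = 0) :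
    ∃ k : K, differential f (Sum.elim a fun j => eval a (g j)) =
      k • differential h (Sum.elim a fun j => eval a (g j)) := by
  let inr : (Fin 2 → K) →ₗ[K] (σ ⊕ Fin 2 → K) :=
    (LinearEquiv.sumArrowLequivProdArrow σ (Fin 2) K K).symm.toLinearMap ∘ₗ LinearMap.inr K _ _
  have hinr (η : Fin 2 → K) : inr η = (Sum.elim 0 η : σ ⊕ Fin 2 → K) := rfl
  have hha' := congrArg (eval a) hgh
  rw [eval_restrictGraph, map_zero] at hha'
  rw [eval_restrictGraph] at hfa
  have hdh : differential (restrictGraph g h) a = 0 := by simp [hgh, differential]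
  set b := fun j => eval a (g j)
  have hne : differential h (Sum.elim a b) ∘ₗ inr ≠ 0 := by
    obtain ⟨η, hη⟩ := hha
    refine fun hzero => hη ?_
    rw [← differential_sumElim_zero_left hh a b η]
    exact LinearMap.congr_fun hzero η
  obtain ⟨k, hk⟩ := exists_eq_smul_of_common_zero (by simp) hne hga
    (ψ := differential f (Sum.elim a b) ∘ₗ inr)
    (by simp [hinr, differential_sumElim_zero_self hh, hha'])
    (by simp [hinr, differential_sumElim_zero_self hf, hfa])
  refine ⟨k, LinearMap.ext fun v => ?_⟩
  have hsplit : v = Sum.elim (v ∘ Sum.inl) (fun j => differential (g j) a (v ∘ Sum.inl)) +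
      inr (v ∘ Sum.inr - fun j => differential (g j) a (v ∘ Sum.inl)) := by
    ext (i | j) <;> simp [hinr]
  rw [hsplit, map_add, ← differential_restrictGraph, hdf, LinearMap.smul_apply, map_add,
    ← differential_restrictGraph, hdh, LinearMap.zero_apply, zero_add, zero_add]
  exact LinearMap.congr_fun hk _

variable [IsAlgClosed K] {n : ℕ}

theorem isNonsingular_restrictGraph (hn : n ≠ 0) (hh : IsBihomogeneous h (n + 1) 1)
    (hf : IsBihomogeneous f 1 (n + 1)) (hns : IsNonsingular (h + f))
    (hgh : restrictGraph g h = 0) (hg : ∀ a, a ≠ 0 → (fun j => eval a (g j)) ≠ 0)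
    (hh0 : ∀ a, a ≠ 0 → ∃ b, eval (Sum.elim a b) h ≠ 0) :
    IsNonsingular (restrictGraph g f) := by
  intro a ha hfa hdf
  obtain ⟨k, hk⟩ := exists_differential_eq_smul hh hf hgh (hg a ha) (hh0 a ha) hfa hdf
  have hha := congrArg (eval a) hgh
  rw [eval_restrictGraph, map_zero] at hha
  rw [eval_restrictGraph] at hfa
  have hb := hg a ha
  set b := fun j => eval a (g j)
  -- Moving `(a, b)` to `(s • a, b)` multiplies `dh` by `s ^ n` relative to `df = k • dh`.
  obtain ⟨s, hs⟩ := IsAlgClosed.exists_pow_nat_eq (-k) (Nat.pos_of_ne_zero hn)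
  have hscale {Ψ : MvPolynomial (σ ⊕ Fin 2) K} {i j : ℕ} (hΨ : IsBihomogeneous Ψ i j) :
      eval (Sum.elim (s • a) b) Ψ = s ^ i * eval (Sum.elim a b) Ψ := by
    simpa using eval_sumElim_smul hΨ s 1 a b
  refine hns (Sum.elim (s • a) b) (fun h0 => hb (congrArg (· ∘ Sum.inr) h0)) ?_ ?_
  · rw [map_add, hscale hh, hscale hf, hha, hfa, mul_zero, mul_zero, add_zero]
  · refine LinearMap.ext fun v => ?_
    have hdh := differential_sumElim_smul (n := 0) hh s 1 a (v ∘ Sum.inl) b (v ∘ Sum.inr)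
    have hdf := differential_sumElim_smul (m := 0) hf s 1 a (v ∘ Sum.inl) b (v ∘ Sum.inr)
    simp only [one_smul, one_pow, mul_one, pow_zero, one_mul, Sum.elim_comp_inl_inr] at hdh hdf
    rw [differential_add, LinearMap.add_apply, hdh, hdf, hk, hs, LinearMap.smul_apply,
      smul_eq_mul, LinearMap.zero_apply]
    ring

end Transversality

section CompLinear

variable {R : Type*} [CommRing R] {σ τ : Type*} [Fintype σ] [DecidableEq σ]

/-- The coordinates of a linear map, as linear forms. -/
def linearForm (A : (σ → R) →ₗ[R] (τ → R)) (j : τ) : MvPolynomial σ R :=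
  ∑ i, C (A (Pi.single i 1) j) * X i

theorem isHomogeneous_linearForm (A : (σ → R) →ₗ[R] (τ → R)) (j : τ) :
    (linearForm A j).IsHomogeneous 1 :=
  IsHomogeneous.sum _ _ _ fun i _ => isHomogeneous_C_mul_X _ i

theorem sum_apply_single_mul (A : (σ → R) →ₗ[R] (τ → R)) (v : σ → R) (j : τ) :
    ∑ i, A (Pi.single i 1) j * v i = A v j := by
  conv_rhs => rw [pi_eq_sum_univ' v]
  simp [mul_comm]

theorem eval_linearForm (A : (σ → R) →ₗ[R] (τ → R)) (v : σ → R) (j : τ) :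
    eval v (linearForm A j) = A v j := by
  simpa [linearForm] using sum_apply_single_mul A v j

theorem differential_linearForm (A : (σ → R) →ₗ[R] (τ → R)) (v w : σ → R) (j : τ) :
    differential (linearForm A j) v w = A w j := by
  simpa [linearForm, differential_sum, differential_mul, differential_C, differential_X]
    using sum_apply_single_mul A w j

/-- The composite of a polynomial with a linear map, as a polynomial. -/
def compLinear (A : (σ → R) →ₗ[R] (τ → R)) (f : MvPolynomial τ R) : MvPolynomial σ R :=
  bind₁ (linearForm A) f

theorem eval_compLinear (A : (σ → R) →ₗ[R] (τ → R)) (f : MvPolynomial τ R) (v : σ → R) :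
    eval v (compLinear A f) = eval (A v) f := by
  rw [compLinear, eval_bind₁]
  simp only [eval_linearForm]

theorem isHomogeneous_compLinear (A : (σ → R) →ₗ[R] (τ → R)) {f : MvPolynomial τ R} {n : ℕ}
    (hf : f.IsHomogeneous n) : (compLinear A f).IsHomogeneous n :=
  isHomogeneous_bind₁_of_isWeightedHomogeneous hf (AddMonoidHom.id ℕ)
    (isHomogeneous_linearForm A)

theorem differential_compLinear [Fintype τ] (A : (σ → R) →ₗ[R] (τ → R)) (f : MvPolynomial τ R)
    (v w : σ → R) : differential (compLinear A f) v w = differential f (A v) (A w) := by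
  rw [compLinear, differential_bind₁]
  simp only [eval_linearForm, differential_linearForm]

theorem isNonsingular_compLinear [Fintype τ] (A : (σ → R) ≃ₗ[R] (τ → R)) {f : MvPolynomial τ R}
    (hf : IsNonsingular f) : IsNonsingular (compLinear A.toLinearMap f) := by
  intro v hv hfv hd
  rw [eval_compLinear] at hfv
  refine hf (A v) (A.map_ne_zero_iff.2 hv) hfv (LinearMap.ext fun w => ?_)
  obtain ⟨w, rfl⟩ := A.surjective w
  exact (differential_compLinear _ _ _ _).symm.trans (LinearMap.congr_fun hd w)

end CompLinear

section VanishingOnLines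

variable {K : Type*} [Field K] [Infinite K] {σ τ : Type*} {N : ℕ}
  {Φ : MvPolynomial (σ ⊕ τ) K}

theorem eval_bihomogeneousComponent_eq_zero (hΦ : Φ.IsHomogeneous N) {a : σ → K} {b : τ → K}
    (h : ∀ t : K, eval (Sum.elim a (t • b)) Φ = 0) {i j : ℕ} (hij : i + j = N) :
    eval (Sum.elim a b) (bihomogeneousComponent i j Φ) = 0 := by
  let P : Polynomial K := ∑ x ∈ Finset.HasAntidiagonal.antidiagonal N,
    Polynomial.C (eval (Sum.elim a b) (bihomogeneousComponent x.1 x.2 Φ)) * Polynomial.X ^ x.2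
  have hP : P = 0 := Polynomial.funext fun t => by
    rw [Polynomial.eval_zero, ← h t]
    conv_rhs => rw [← sum_bihomogeneousComponent hΦ]
    simp only [P, Polynomial.eval_finsetSum, map_sum]
    refine Finset.sum_congr rfl fun x _ => ?_
    have hsmul := eval_sumElim_smul (isBihomogeneous_bihomogeneousComponent x.1 x.2 Φ) 1 t a b
    rw [one_smul, one_pow, one_mul] at hsmul
    rw [hsmul, Polynomial.eval_C_mul, Polynomial.eval_pow, Polynomial.eval_X, mul_comm]
  have hcoeff : P.coeff j = eval (Sum.elim a b) (bihomogeneousComponent i j Φ) := by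
    simp only [P, Polynomial.finsetSum_coeff, Polynomial.coeff_C_mul_X_pow]
    rw [Finset.sum_eq_single_of_mem (i, j) (by simpa using hij), if_pos rfl]
    rintro ⟨k, l⟩ hkl hne
    refine if_neg fun hl => hne ?_
    rw [Finset.HasAntidiagonal.mem_antidiagonal] at hkl
    ext <;> lia
  rw [← hcoeff, hP, Polynomial.coeff_zero]

theorem sum_bihomogeneousComponent_succ_succ (hΦ : Φ.IsHomogeneous (N + 2))
    (hl : ∀ a, eval (Sum.elim a 0) Φ = 0) (hr : ∀ b, eval (Sum.elim 0 b) Φ = 0) :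
    ∑ x ∈ Finset.HasAntidiagonal.antidiagonal N, bihomogeneousComponent (x.1 + 1) (x.2 + 1) Φ =
      Φ := by
  have hleft : bihomogeneousComponent (N + 2) 0 Φ = 0 := MvPolynomial.funext fun v => by
    have h := eval_sumElim_smul (isBihomogeneous_bihomogeneousComponent (N + 2) 0 Φ) 1 0
      (v ∘ Sum.inl) (v ∘ Sum.inr)
    rw [eval_bihomogeneousComponent_eq_zero hΦ (fun t => by simp [hl]) (add_zero _)] at h
    simpa using h.symm
  have hright : bihomogeneousComponent 0 (N + 2) Φ = 0 := MvPolynomial.funext fun v => by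
    have h := eval_sumElim_smul (isBihomogeneous_bihomogeneousComponent 0 (N + 2) Φ) 0 1
      (v ∘ Sum.inl) (v ∘ Sum.inr)
    rw [eval_bihomogeneousComponent_eq_zero hΦ (fun t => by simp [hr]) (zero_add _)] at h
    simpa using h.symm
  conv_rhs => rw [← sum_bihomogeneousComponent hΦ]
  rw [Finset.Nat.antidiagonal_succ_succ']
  simp [hleft, hright]

end VanishingOnLines

theorem exists_crossingMap {K : Type*} [Field K] [Infinite K] {σ : Type*} [Fintype σ] {N : ℕ}
    {Φ : MvPolynomial (σ ⊕ Fin 2) K}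
    (hΦ : ∑ x ∈ Finset.HasAntidiagonal.antidiagonal N,
      bihomogeneousComponent (x.1 + 1) (x.2 + 1) Φ = Φ) (hns : IsNonsingular Φ) :
    ∃ g : Fin 2 → MvPolynomial σ K, (∀ j, (g j).IsHomogeneous (N + 1)) ∧
      (∀ a, a ≠ 0 → (fun j => eval a (g j)) ≠ 0) ∧
      restrictGraph g (bihomogeneousComponent (N + 1) 1 Φ) = 0 ∧
      ∀ a b, a ≠ 0 → eval (Sum.elim a b) (bihomogeneousComponent (N + 1) 1 Φ) = 0 →
        ∃ c : K, b = c • fun j => eval a (g j) := by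
  obtain ⟨g, hg, hgΦ⟩ := exists_eval_eq_sub_of_isBihomogeneous
    (isBihomogeneous_bihomogeneousComponent (N + 1) 1 Φ)
  have hg0 (a : σ → K) (ha : a ≠ 0) : (fun j => eval a (g j)) ≠ 0 := by
    obtain ⟨b, hb⟩ := exists_eval_bihomogeneousComponent_ne_zero hΦ hns ha
    intro h
    exact hb (by simp [hgΦ, congrFun h 0, congrFun h 1])
  refine ⟨g, hg, hg0, MvPolynomial.funext fun a => ?_, fun a b ha hab => ?_⟩
  · rw [eval_restrictGraph, hgΦ, map_zero]
    ring
  · rw [hgΦ] at hab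
    exact exists_eq_smul_of_mul_sub_mul_eq_zero (hg0 a ha) hab

section AdaptedCoordinates

theorem sumElim_ne_zero_of_left {σ τ R : Type*} [Zero R] {a : σ → R} (ha : a ≠ 0) (b : τ → R) :
    Sum.elim a b ≠ 0 :=
  fun h => ha (congrArg (· ∘ Sum.inl) h)

theorem sumElim_ne_zero_of_right {σ τ R : Type*} [Zero R] (a : σ → R) {b : τ → R} (hb : b ≠ 0) :
    Sum.elim a b ≠ 0 :=
  fun h => hb (congrArg (· ∘ Sum.inr) h)

theorem mk_mem_setOf_submodule_le {K V : Type*} [DivisionRing K] [AddCommGroup V] [Module K V]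
    {L : Submodule K V} {v : V} (hv : v ≠ 0) :
    Projectivization.mk K v hv ∈ {p : ℙ K V | p.submodule ≤ L} ↔ v ∈ L := by
  rw [Set.mem_ofPred_eq, Projectivization.submodule_mk, Submodule.span_singleton_le_iff_mem]

/-- Linear coordinates `(a, b)` on `ℂ⁴` in which the lines `l'` and `l''` have the equations
`b = 0` and `a = 0`. -/
structure AdaptedCoordinates (l' l'' : Set P3) where
  /-- The coordinates, as a parametrization of `ℂ⁴`. -/
  toEquiv : (Fin 2 ⊕ Fin 2 → ℂ) ≃ₗ[ℂ] Vec4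
  mk_mem_left : ∀ x (hx : toEquiv x ≠ 0),
    Projectivization.mk ℂ (toEquiv x) hx ∈ l' ↔ x ∘ Sum.inr = 0
  mk_mem_right : ∀ x (hx : toEquiv x ≠ 0),
    Projectivization.mk ℂ (toEquiv x) hx ∈ l'' ↔ x ∘ Sum.inl = 0

theorem isCompl_of_disjoint_lines {L' L'' : Submodule ℂ Vec4} (h' : Module.finrank ℂ L' = 2)
    (h'' : Module.finrank ℂ L'' = 2)
    (hdisj : Disjoint {p : P3 | p.submodule ≤ L'} {p : P3 | p.submodule ≤ L''}) :
    IsCompl L' L'' := by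
  refine (Submodule.isCompl_iff_disjoint _ _ (by simp [h', h''])).2 ?_
  rw [Submodule.disjoint_def]
  intro v hv' hv''
  by_contra hv
  exact Set.disjoint_left.1 hdisj ((mk_mem_setOf_submodule_le hv).2 hv')
    ((mk_mem_setOf_submodule_le hv).2 hv'')

theorem nonempty_adaptedCoordinates {l' l'' : Set P3} (hl' : IsLine l') (hl'' : IsLine l'')
    (hdisj : Disjoint l' l'') : Nonempty (AdaptedCoordinates l' l'') := by
  obtain ⟨L', h', rfl⟩ := hl'
  obtain ⟨L'', h'', rfl⟩ := hl''
  have hc := isCompl_of_disjoint_lines h' h'' hdisj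
  let e' : (Fin 2 → ℂ) ≃ₗ[ℂ] L' := LinearEquiv.ofFinrankEq _ _ (by simp [h'])
  let e'' : (Fin 2 → ℂ) ≃ₗ[ℂ] L'' := LinearEquiv.ofFinrankEq _ _ (by simp [h''])
  let B : (Fin 2 ⊕ Fin 2 → ℂ) ≃ₗ[ℂ] Vec4 :=
    (LinearEquiv.sumArrowLequivProdArrow (Fin 2) (Fin 2) ℂ ℂ).trans
      ((e'.prodCongr e'').trans (Submodule.prodEquivOfIsCompl L' L'' hc))
  have hB (x) : B x = (e' (x ∘ Sum.inl) : Vec4) + e'' (x ∘ Sum.inr) := rfl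
  refine ⟨⟨B, fun x hx => ?_, fun x hx => ?_⟩⟩
  · rw [mk_mem_setOf_submodule_le, hB, Submodule.add_mem_iff_right _ (Subtype.mem _)]
    refine ⟨fun hx => ?_, fun hx => by rw [hx, map_zero]; exact L'.zero_mem⟩
    simpa using Submodule.disjoint_def.1 hc.disjoint _ hx (Subtype.mem _)
  · rw [mk_mem_setOf_submodule_le, hB, Submodule.add_mem_iff_left _ (Subtype.mem _)]
    refine ⟨fun hx => ?_, fun hx => by rw [hx, map_zero]; exact L''.zero_mem⟩
    simpa using Submodule.disjoint_def.1 hc.disjoint _ (Subtype.mem _) hx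

end AdaptedCoordinates

namespace AdaptedCoordinates

variable {l' l'' : Set P3} (B : AdaptedCoordinates l' l'')

theorem toEquiv_ne_zero {x : Fin 2 ⊕ Fin 2 → ℂ} (hx : x ≠ 0) : B.toEquiv x ≠ 0 :=
  B.toEquiv.map_ne_zero_iff.2 hx

/-- The point of `ℙ³` with given homogeneous coordinates. -/
def point (x : Fin 2 ⊕ Fin 2 → ℂ) (hx : x ≠ 0) : P3 :=
  Projectivization.mk ℂ (B.toEquiv x) (B.toEquiv_ne_zero hx)

theorem exists_eq_point (p : P3) : ∃ x hx, p = B.point x hx := by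
  induction p using Projectivization.ind with | h v hv =>
  obtain ⟨x, rfl⟩ := B.toEquiv.surjective v
  exact ⟨x, B.toEquiv.map_ne_zero_iff.1 hv, rfl⟩

theorem point_mem_left {x : Fin 2 ⊕ Fin 2 → ℂ} (hx : x ≠ 0) :
    B.point x hx ∈ l' ↔ x ∘ Sum.inr = 0 :=
  B.mk_mem_left x _

theorem point_mem_right {x : Fin 2 ⊕ Fin 2 → ℂ} (hx : x ≠ 0) :
    B.point x hx ∈ l'' ↔ x ∘ Sum.inl = 0 :=
  B.mk_mem_right x _

/-- The line joining the point `(a, 0)` of `l'` and the point `(0, b)` of `l''`. -/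
def joinLine (a b : Fin 2 → ℂ) : Set P3 :=
  {p | p.submodule ≤ Submodule.span ℂ {B.toEquiv (Sum.elim a 0), B.toEquiv (Sum.elim 0 b)}}

theorem point_mem_joinLine {a b : Fin 2 → ℂ} {x : Fin 2 ⊕ Fin 2 → ℂ} (hx : x ≠ 0) :
    B.point x hx ∈ B.joinLine a b ↔ ∃ s t : ℂ, Sum.elim (s • a) (t • b) = x := by
  have hcomb (s t : ℂ) : s • B.toEquiv (Sum.elim a 0) + t • B.toEquiv (Sum.elim 0 b) =
      B.toEquiv (Sum.elim (s • a) (t • b)) := by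
    rw [← map_smul, ← map_smul, ← map_add]
    congr 1
    ext (i | i) <;> simp
  simp only [joinLine, point, mk_mem_setOf_submodule_le, Submodule.mem_span_pair, hcomb,
    B.toEquiv.injective.eq_iff]

theorem left_mem_joinLine {a : Fin 2 → ℂ} (ha : a ≠ 0) (b : Fin 2 → ℂ) :
    B.point _ (sumElim_ne_zero_of_left ha (0 : Fin 2 → ℂ)) ∈ B.joinLine a b :=
  (B.point_mem_joinLine _).2 ⟨1, 0, by simp⟩

theorem right_mem_joinLine (a : Fin 2 → ℂ) {b : Fin 2 → ℂ} (hb : b ≠ 0) :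
    B.point _ (sumElim_ne_zero_of_right (0 : Fin 2 → ℂ) hb) ∈ B.joinLine a b :=
  (B.point_mem_joinLine _).2 ⟨0, 1, by simp⟩

theorem joinLine_inter_left_nonempty {a : Fin 2 → ℂ} (ha : a ≠ 0) (b : Fin 2 → ℂ) :
    (B.joinLine a b ∩ l').Nonempty :=
  ⟨_, B.left_mem_joinLine ha b, (B.point_mem_left _).2 rfl⟩

theorem joinLine_inter_right_nonempty (a : Fin 2 → ℂ) {b : Fin 2 → ℂ} (hb : b ≠ 0) :
    (B.joinLine a b ∩ l'').Nonempty :=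
  ⟨_, B.right_mem_joinLine a hb, (B.point_mem_right _).2 rfl⟩

theorem joinLine_ne_left (a : Fin 2 → ℂ) {b : Fin 2 → ℂ} (hb : b ≠ 0) : B.joinLine a b ≠ l' :=
  fun h => hb ((B.point_mem_left _).1 (h.subset (B.right_mem_joinLine a hb)))

theorem joinLine_ne_right {a : Fin 2 → ℂ} (ha : a ≠ 0) (b : Fin 2 → ℂ) : B.joinLine a b ≠ l'' :=
  fun h => ha ((B.point_mem_right _).1 (h.subset (B.left_mem_joinLine ha b)))

theorem exists_eq_smul_of_joinLine_eq {a a' b b' : Fin 2 → ℂ} (ha : a ≠ 0)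
    (h : B.joinLine a b = B.joinLine a' b') : ∃ c : ℂ, a = c • a' := by
  obtain ⟨s, t, hst⟩ := (B.point_mem_joinLine _).1 (h.subset (B.left_mem_joinLine ha b))
  exact ⟨s, congrArg (· ∘ Sum.inl) hst.symm⟩

theorem finrank_span_sumElim {a b : Fin 2 → ℂ} (ha : a ≠ 0) (hb : b ≠ 0) :
    Module.finrank ℂ (Submodule.span ℂ
      {B.toEquiv (Sum.elim a 0), B.toEquiv (Sum.elim 0 b)}) = 2 := by
  have hindep : LinearIndependent ℂ ![B.toEquiv (Sum.elim a 0), B.toEquiv (Sum.elim 0 b)] := by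
    rw [LinearIndependent.pair_iff' (B.toEquiv_ne_zero (sumElim_ne_zero_of_left ha 0))]
    intro c hc
    rw [← map_smul, B.toEquiv.injective.eq_iff] at hc
    exact hb (funext fun j => by simpa using (congrFun hc (Sum.inr j)).symm)
  rw [← Matrix.range_cons_cons_empty _ _ ![], finrank_span_eq_card hindep, Fintype.card_fin]

theorem isLine_joinLine {a b : Fin 2 → ℂ} (ha : a ≠ 0) (hb : b ≠ 0) : IsLine (B.joinLine a b) :=
  ⟨_, B.finrank_span_sumElim ha hb, rfl⟩

theorem exists_eq_joinLine {m : Set P3} (hm : IsLine m) (hm' : (m ∩ l').Nonempty)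
    (hm'' : (m ∩ l'').Nonempty) : ∃ a b, a ≠ 0 ∧ b ≠ 0 ∧ m = B.joinLine a b := by
  obtain ⟨M, hM, rfl⟩ := hm
  obtain ⟨p, hpM, hp⟩ := hm'
  obtain ⟨q, hqM, hq⟩ := hm''
  obtain ⟨x, hx, rfl⟩ := B.exists_eq_point p
  obtain ⟨y, hy, rfl⟩ := B.exists_eq_point q
  rw [B.point_mem_left] at hp
  rw [B.point_mem_right] at hq
  obtain ⟨a, rfl⟩ : ∃ a : Fin 2 → ℂ, x = Sum.elim a (0 : Fin 2 → ℂ) :=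
    ⟨_, by rw [← hp, Sum.elim_comp_inl_inr]⟩
  obtain ⟨b, rfl⟩ : ∃ b : Fin 2 → ℂ, y = Sum.elim (0 : Fin 2 → ℂ) b :=
    ⟨_, by rw [← hq, Sum.elim_comp_inl_inr]⟩
  have ha : a ≠ 0 := fun h => hx (by simp [h])
  have hb : b ≠ 0 := fun h => hy (by simp [h])
  have hle : Submodule.span ℂ {B.toEquiv (Sum.elim a 0), B.toEquiv (Sum.elim 0 b)} ≤ M := by
    rw [Submodule.span_le, Set.pair_subset_iff]
    exact ⟨(mk_mem_setOf_submodule_le _).1 hpM, (mk_mem_setOf_submodule_le _).1 hqM⟩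
  refine ⟨a, b, ha, hb, ?_⟩
  rw [joinLine, Submodule.eq_of_le_of_finrank_eq hle (by rw [hM, B.finrank_span_sumElim ha hb])]

theorem joinLine_smul_right (a b : Fin 2 → ℂ) {c : ℂ} (hc : c ≠ 0) :
    B.joinLine a (c • b) = B.joinLine a b := by
  ext p
  obtain ⟨x, hx, rfl⟩ := B.exists_eq_point p
  simp only [point_mem_joinLine, smul_smul]
  refine exists_congr fun s => ⟨fun ⟨t, ht⟩ => ⟨t * c, ht⟩, fun ⟨t, ht⟩ => ⟨t / c, ?_⟩⟩
  rwa [div_mul_cancel₀ _ hc]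

theorem joinLine_smul_left (a b : Fin 2 → ℂ) {c : ℂ} (hc : c ≠ 0) :
    B.joinLine (c • a) b = B.joinLine a b := by
  ext p
  obtain ⟨x, hx, rfl⟩ := B.exists_eq_point p
  simp only [point_mem_joinLine, smul_smul]
  refine ⟨fun ⟨s, t, h⟩ => ⟨s * c, t, h⟩, fun ⟨s, t, h⟩ => ⟨s / c, t, ?_⟩⟩
  rwa [div_mul_cancel₀ _ hc]

end AdaptedCoordinates

theorem SmoothQuartic.isNonsingular_poly (X : SmoothQuartic) : IsNonsingular X.poly := by
  intro v hv h hd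
  obtain ⟨i, hi⟩ := X.smooth v hv h
  exact hi (by
    simpa [differential_apply, Pi.single_apply] using LinearMap.congr_fun hd (Pi.single i 1))

namespace AdaptedCoordinates

variable {l' l'' : Set P3} (B : AdaptedCoordinates l' l'') (X : SmoothQuartic)

/-- The equation of `X` in the coordinates `B`. -/
def form : MvPolynomial (Fin 2 ⊕ Fin 2) ℂ :=
  compLinear B.toEquiv.toLinearMap X.poly

theorem eval_form (x : Fin 2 ⊕ Fin 2 → ℂ) : eval x (B.form X) = eval (B.toEquiv x) X.poly :=
  eval_compLinear _ _ _

theorem isHomogeneous_form : (B.form X).IsHomogeneous 4 :=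
  isHomogeneous_compLinear _ X.homogeneous

theorem isNonsingular_form : IsNonsingular (B.form X) :=
  isNonsingular_compLinear B.toEquiv X.isNonsingular_poly

variable {X}

theorem point_mem_surface {x : Fin 2 ⊕ Fin 2 → ℂ} (hx : x ≠ 0) :
    B.point x hx ∈ X.surface ↔ eval x (B.form X) = 0 := by
  rw [point, X.mk_mem_surface, SmoothQuartic.cone, Set.mem_ofPred_eq, eval_form]
  exact and_iff_right (B.toEquiv_ne_zero hx)

theorem eval_form_zero : eval 0 (B.form X) = 0 := by
  simpa using eval_smul (B.isHomogeneous_form X) 0 0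

theorem joinLine_subset_surface {a b : Fin 2 → ℂ} : B.joinLine a b ⊆ X.surface ↔
    ∀ s t : ℂ, eval (Sum.elim (s • a) (t • b)) (B.form X) = 0 := by
  refine ⟨fun h s t => ?_, fun h p hp => ?_⟩
  · rcases eq_or_ne (Sum.elim (s • a) (t • b)) 0 with h0 | h0
    · rw [h0, eval_form_zero]
    · exact (B.point_mem_surface h0).1 (h ((B.point_mem_joinLine h0).2 ⟨s, t, rfl⟩))
  · obtain ⟨x, hx, rfl⟩ := B.exists_eq_point p
    obtain ⟨s, t, rfl⟩ := (B.point_mem_joinLine hx).1 hp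
    exact (B.point_mem_surface hx).2 (h s t)

theorem sum_bihomogeneousComponent_form (h' : l' ⊆ X.surface) (h'' : l'' ⊆ X.surface) :
    ∑ x ∈ Finset.HasAntidiagonal.antidiagonal 2,
      bihomogeneousComponent (x.1 + 1) (x.2 + 1) (B.form X) = B.form X := by
  refine sum_bihomogeneousComponent_succ_succ (B.isHomogeneous_form X) (fun a => ?_) fun b => ?_
  · rcases eq_or_ne (Sum.elim a (0 : Fin 2 → ℂ)) 0 with h0 | h0
    · rw [h0, eval_form_zero]
    · exact (B.point_mem_surface h0).1 (h' ((B.point_mem_left h0).2 rfl))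
  · rcases eq_or_ne (Sum.elim (0 : Fin 2 → ℂ) b) 0 with h0 | h0
    · rw [h0, eval_form_zero]
    · exact (B.point_mem_surface h0).1 (h'' ((B.point_mem_right h0).2 rfl))

theorem add_add_bihomogeneousComponent_form (h' : l' ⊆ X.surface) (h'' : l'' ⊆ X.surface) :
    bihomogeneousComponent 3 1 (B.form X) + bihomogeneousComponent 2 2 (B.form X) +
      bihomogeneousComponent 1 3 (B.form X) = B.form X := by
  conv_rhs => rw [← B.sum_bihomogeneousComponent_form h' h'',
    Finset.Nat.sum_antidiagonal_eq_sum_range_succ_mk]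
  simp only [Finset.sum_range_succ, Finset.sum_range_zero]
  ring

theorem eval_form_sumElim_smul (h' : l' ⊆ X.surface) (h'' : l'' ⊆ X.surface) (a b : Fin 2 → ℂ)
    (s t : ℂ) : eval (Sum.elim (s • a) (t • b)) (B.form X) =
      s * t * (s ^ 2 * eval (Sum.elim a b) (bihomogeneousComponent 3 1 (B.form X)) +
        s * t * eval (Sum.elim a b) (bihomogeneousComponent 2 2 (B.form X)) +
        t ^ 2 * eval (Sum.elim a b) (bihomogeneousComponent 1 3 (B.form X))) := by
  conv_lhs => rw [← B.add_add_bihomogeneousComponent_form h' h'']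
  simp only [map_add, eval_sumElim_smul (isBihomogeneous_bihomogeneousComponent _ _ _)]
  ring

theorem eval_bihomogeneousComponent_form_eq_zero {a b : Fin 2 → ℂ} {i j : ℕ}
    (h : B.joinLine a b ⊆ X.surface) (hij : i + j = 4) :
    eval (Sum.elim a b) (bihomogeneousComponent i j (B.form X)) = 0 :=
  eval_bihomogeneousComponent_eq_zero (B.isHomogeneous_form X)
    (fun t => by simpa using B.joinLine_subset_surface.1 h 1 t) hij

theorem joinLine_graph_smul {g : Fin 2 → MvPolynomial (Fin 2) ℂ} {d : ℕ}
    (hg : ∀ j, (g j).IsHomogeneous d) (a : Fin 2 → ℂ) {c : ℂ} (hc : c ≠ 0) :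
    B.joinLine (c • a) (fun j => eval (c • a) (g j)) = B.joinLine a fun j => eval a (g j) := by
  have hgc : (fun j => eval (c • a) (g j)) = c ^ d • fun j => eval a (g j) :=
    funext fun j => eval_smul (hg j) c a
  rw [hgc, joinLine_smul_left _ _ _ hc, joinLine_smul_right _ _ _ (pow_ne_zero d hc)]

theorem joinLine_graph_subset_surface (h' : l' ⊆ X.surface) (h'' : l'' ⊆ X.surface)
    (h : bihomogeneousComponent 2 2 (B.form X) = 0) {g : Fin 2 → MvPolynomial (Fin 2) ℂ}
    (hg : restrictGraph g (bihomogeneousComponent 3 1 (B.form X)) = 0) {a : Fin 2 → ℂ}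
    (ha : eval a (restrictGraph g (bihomogeneousComponent 1 3 (B.form X))) = 0) :
    B.joinLine a (fun j => eval a (g j)) ⊆ X.surface := by
  refine B.joinLine_subset_surface.2 fun s t => ?_
  have hga := congrArg (eval a) hg
  rw [eval_restrictGraph, map_zero] at hga
  rw [eval_restrictGraph] at ha
  rw [B.eval_form_sumElim_smul h' h'', hga, ha, h, map_zero]
  ring

theorem bihomogeneousComponent_two_two_eq_zero (h : X.AreTwinLines l' l'') :
    bihomogeneousComponent 2 2 (B.form X) = 0 := by
  obtain ⟨-, -, h', h'', -, m, hm, hml⟩ := h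
  obtain ⟨g, hg, hg0, -, hgΦ⟩ := exists_crossingMap
    (B.sum_bihomogeneousComponent_form h' h'') (B.isNonsingular_form X)
  have hjoin (i : Fin 10) : ∃ a, a ≠ 0 ∧ m i = B.joinLine a fun j => eval a (g j) := by
    obtain ⟨hline, hsub, -, -, hmeet', hmeet''⟩ := hml i
    obtain ⟨a, b, ha, hb, hab⟩ := B.exists_eq_joinLine hline hmeet' hmeet''
    obtain ⟨c, rfl⟩ := hgΦ a b ha
      (B.eval_bihomogeneousComponent_form_eq_zero (hab ▸ hsub) rfl)
    exact ⟨a, ha, hab.trans (B.joinLine_smul_right _ _ (left_ne_zero_of_smul hb))⟩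
  choose a ha hma using hjoin
  have hindep : Pairwise fun i j => LinearIndependent ℂ ![a i, a j] := by
    intro i j hij
    rw [LinearIndependent.pair_iff' (ha i)]
    intro c hc
    have hc0 : c ≠ 0 := left_ne_zero_of_smul (hc ▸ ha j)
    exact hij (hm (by rw [hma i, hma j, ← hc, B.joinLine_graph_smul hg _ hc0]))
  have hzero : restrictGraph g (bihomogeneousComponent 2 2 (B.form X)) = 0 := by
    refine eq_zero_of_lt_card_zeros
      (isHomogeneous_restrictGraph hg (isBihomogeneous_bihomogeneousComponent 2 2 _)) ha hindep
      (fun i => ?_) (by simp)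
    rw [eval_restrictGraph]
    exact B.eval_bihomogeneousComponent_form_eq_zero (hma i ▸ (hml i).2.1) rfl
  exact eq_zero_of_restrictGraph_eq_zero (by simp) hg hg0
    (isBihomogeneous_bihomogeneousComponent 2 2 _) hzero

theorem areTwinLines (hl' : IsLine l') (hl'' : IsLine l'') (hdisj : Disjoint l' l'')
    (h' : l' ⊆ X.surface) (h'' : l'' ⊆ X.surface)
    (h : bihomogeneousComponent 2 2 (B.form X) = 0) : X.AreTwinLines l' l'' := by
  have hsum := B.sum_bihomogeneousComponent_form h' h''
  have hns := B.isNonsingular_form X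
  obtain ⟨g, hg, hg0, hgΦ, -⟩ := exists_crossingMap hsum hns
  have hns' : IsNonsingular
      (bihomogeneousComponent 3 1 (B.form X) + bihomogeneousComponent 1 3 (B.form X)) := by
    rwa [← B.add_add_bihomogeneousComponent_form h' h'', h, add_zero] at hns
  obtain ⟨a, ha0, hza, ha⟩ := exists_zeros_of_isNonsingular
    (isHomogeneous_restrictGraph hg (isBihomogeneous_bihomogeneousComponent 1 3 _))
    (isNonsingular_restrictGraph two_ne_zero (isBihomogeneous_bihomogeneousComponent 3 1 _)
      (isBihomogeneous_bihomogeneousComponent 1 3 _) hns' hgΦ hg0 fun a ha =>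
        exists_eval_bihomogeneousComponent_ne_zero hsum (B.isNonsingular_form X) ha)
  refine ⟨hl', hl'', h', h'', hdisj, fun i => B.joinLine (a i) fun j => eval (a i) (g j),
    fun i j hij => ?_, fun i => ?_⟩
  · by_contra hne
    obtain ⟨c, hc⟩ := B.exists_eq_smul_of_joinLine_eq (ha0 j) hij.symm
    exact (LinearIndependent.pair_iff' (ha0 i)).1 (ha hne) c hc.symm
  · exact ⟨B.isLine_joinLine (ha0 i) (hg0 _ (ha0 i)),
      B.joinLine_graph_subset_surface h' h'' h hgΦ (hza i), B.joinLine_ne_left _ (hg0 _ (ha0 i)),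
      B.joinLine_ne_right (ha0 i) _, B.joinLine_inter_left_nonempty (ha0 i) _,
      B.joinLine_inter_right_nonempty _ (hg0 _ (ha0 i))⟩

end AdaptedCoordinates

section DetForm

variable {K : Type*} [Field K] {d : ℕ}

/-- The alternating form `w ↦ det (n, v, w₀, …)`. -/
def detForm (n v : Fin (d + 2) → K) : (Fin (d + 2) → K) [⋀^Fin d]→ₗ[K] K :=
  ((Pi.basisFun K (Fin (d + 2))).det.curryLeft n).curryLeft v

theorem detForm_apply (n v : Fin (d + 2) → K) (w : Fin d → Fin (d + 2) → K) :
    detForm n v w = (Pi.basisFun K (Fin (d + 2))).det (Fin.cons n (Fin.cons v w)) :=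
  rfl

theorem detForm_map (A : (Fin (d + 2) → K) →ₗ[K] (Fin (d + 2) → K)) (n v : Fin (d + 2) → K)
    (w : Fin d → Fin (d + 2) → K) :
    detForm (A n) (A v) (fun i => A (w i)) = LinearMap.det A * detForm n v w := by
  rw [detForm_apply, detForm_apply, ← Module.Basis.det_comp, Fin.comp_cons, Fin.comp_cons]
  rfl

theorem detForm_eq_zero_of_apply_eq (n : Fin (d + 2) → K) {v : Fin (d + 2) → K}
    {w : Fin d → Fin (d + 2) → K} (i : Fin d) (h : w i = v) : detForm n v w = 0 := by
  rw [detForm_apply]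
  exact AlternatingMap.map_eq_zero_of_eq _ _ (i := Fin.succ 0) (j := i.succ.succ) h.symm
    fun hi => Fin.succ_ne_zero i (Fin.succ_injective _ hi).symm

theorem detForm_smul_sub_smul (a a' : K) (n n' v : Fin (d + 2) → K)
    (w : Fin d → Fin (d + 2) → K) :
    detForm (a • n - a' • n') v w = a * detForm n v w - a' * detForm n' v w := by
  simp [detForm, sub_eq_add_neg, ← neg_smul]

theorem detForm_eq_zero_of_ker {f : (Fin (d + 2) → K) →ₗ[K] K} (hf : f ≠ 0)
    {n v : Fin (d + 2) → K} {w : Fin d → Fin (d + 2) → K} (hn : f n = 0) (hv : f v = 0)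
    (hw : ∀ i, f (w i) = 0) : detForm n v w = 0 := by
  rw [detForm_apply]
  refine AlternatingMap.map_linearDependent _ _ fun hli => hf ?_
  have htop := hli.span_eq_top_of_card_eq_finrank (by simp)
  refine LinearMap.ker_eq_top.1 (top_le_iff.1 (htop ▸ Submodule.span_le.2 ?_))
  rintro _ ⟨i, rfl⟩
  exact Fin.cases hn (Fin.cases hv hw) i

theorem inv_mul_detForm_eq {f : (Fin (d + 2) → K) →ₗ[K] K} {n n' v : Fin (d + 2) → K}
    {w : Fin d → Fin (d + 2) → K} (hn : f n ≠ 0) (hn' : f n' ≠ 0) (hv : f v = 0)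
    (hw : ∀ i, f (w i) = 0) : (f n)⁻¹ * detForm n v w = (f n')⁻¹ * detForm n' v w := by
  have hf : f ≠ 0 := fun h => hn (by rw [h, LinearMap.zero_apply])
  have h := detForm_eq_zero_of_ker hf (n := f n' • n - f n • n') (by simp [mul_comm]) hv hw
  rw [detForm_smul_sub_smul] at h
  field_simp
  linear_combination h

theorem exists_linearIndependent_finCons {V : Type*} [AddCommGroup V] [Module K V] {v : V}
    (hv : v ≠ 0) {m : ℕ} (hm : m < Module.finrank K V) :
    ∃ w : Fin m → V, LinearIndependent K (Fin.cons v w : Fin (m + 1) → V) := by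
  induction m with
  | zero => exact ⟨Fin.elim0, LinearIndependent.of_subsingleton (ι := Fin 1) 0 hv⟩
  | succ m ih =>
    obtain ⟨w, hw⟩ := ih (by lia)
    obtain ⟨x, hx⟩ := exists_linearIndependent_snoc_of_lt_finrank hw hm
    exact ⟨Fin.snoc w x, by rwa [Fin.cons_snoc_eq_snoc_cons]⟩

theorem exists_detForm_ne_zero {f : (Fin (d + 2) → K) →ₗ[K] K} {n v : Fin (d + 2) → K}
    (hn : f n ≠ 0) (hv : f v = 0) (hv0 : v ≠ 0) :
    ∃ w : Fin d → Fin (d + 2) → K, (∀ i, f (w i) = 0) ∧ detForm n v w ≠ 0 := by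
  have hf : f ≠ 0 := fun h => hn (by rw [h, LinearMap.zero_apply])
  have hrank : Module.finrank K (LinearMap.ker f) = d + 1 := by
    have h := f.finrank_range_add_finrank_ker
    rw [LinearMap.range_eq_top.2 (LinearMap.surjective hf), finrank_top, Module.finrank_self,
      Module.finrank_fin_fun] at h
    lia
  obtain ⟨w, hw⟩ := exists_linearIndependent_finCons (K := K) (v := (⟨v, hv⟩ : LinearMap.ker f))
    (fun h => hv0 (congrArg Subtype.val h)) (m := d) (by lia)
  have hw' := hw.map' (LinearMap.ker f).subtype (Submodule.ker_subtype _)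
  rw [Fin.comp_cons] at hw'
  have hli : LinearIndependent K
      (Fin.cons n (Fin.cons v fun i => w i) : Fin (d + 2) → Fin (d + 2) → K) := by
    refine linearIndependent_finCons.2 ⟨hw', fun hmem => hn ?_⟩
    refine (Submodule.span_le (p := LinearMap.ker f)).2 ?_ hmem
    rintro _ ⟨i, rfl⟩
    exact Fin.cases hv (fun i => (w i).2) i
  refine ⟨fun i => w i, fun i => (w i).2, ?_⟩
  exact ((Module.Basis.is_basis_iff_det _).1
    ⟨hli, hli.span_eq_top_of_card_eq_finrank (by simp)⟩).ne_zero

theorem differentiable_detForm (n : Fin (d + 2) → ℂ) (w : Fin d → Fin (d + 2) → ℂ) :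
    Differentiable ℂ fun v => detForm n v w := by
  let T : (Fin (d + 2) → ℂ) →ₗ[ℂ] ℂ :=
    { toFun := fun v => detForm n v w
      map_add' := fun x y => by simp [detForm]
      map_smul' := fun c x => by simp [detForm] }
  exact (LinearMap.toContinuousLinearMap T).differentiable

end DetForm

section ResidueForm

theorem differentiable_polyDiff (F : MvPolynomial (Fin 4) ℂ) (n : Vec4) :
    Differentiable ℂ fun x => polyDiff F x n := by
  have heval (G : MvPolynomial (Fin 4) ℂ) : Differentiable ℂ fun x : Vec4 => eval x G :=
    fun x => (hasStrictFDerivAt_eval G x).hasFDerivAt.differentiableAt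
  have hsum : (fun x => polyDiff F x n) = fun x => ∑ i, eval x (pderiv i F) * n i :=
    funext fun x => differential_apply F x n
  rw [hsum]
  exact Differentiable.fun_sum fun i _ => (heval _).mul_const _

theorem differential_map_of_eval_map {R : Type*} [CommRing R] [IsDomain R] [Infinite R]
    {σ τ : Type*} [Fintype σ] [Fintype τ] {f : MvPolynomial τ R}
    {g : MvPolynomial σ R} (A : (σ → R) →ₗ[R] (τ → R)) {k : R}
    (h : ∀ x, eval (A x) f = k * eval x g) (v w : σ → R) :
    differential f (A v) (A w) = k * differential g v w := by
  classical
  have hcomp : compLinear A f = C k * g :=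
    MvPolynomial.funext fun x => by rw [eval_compLinear, h, map_mul, eval_C]
  rw [← differential_compLinear, hcomp, differential_mul, differential_C]
  simp

namespace SmoothQuartic

variable (X : SmoothQuartic)

theorem polyDiff_self {v : Vec4} (hv : v ∈ X.cone) : polyDiff X.poly v v = 0 :=
  (differential_apply_self X.homogeneous v).trans (by rw [hv.2, mul_zero])

theorem exists_polyDiff_ne_zero (v : X.cone) : ∃ n, polyDiff X.poly v n ≠ 0 := by
  by_contra! h
  exact X.isNonsingular_poly v v.2.1 v.2.2 (LinearMap.ext h)

/-- The residue on the cone of the meromorphic form `Ω / F`, where `Ω` is the contraction of the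
volume form of `ℂ⁴` with the radial vector field: at `v` it is `det (n, v, ·, ·) / dF (n)`, for
any vector `n` with `dF (n) ≠ 0`. -/
def residueForm (v : X.cone) : X.tangent v [⋀^Fin 2]→ₗ[ℂ] ℂ :=
  (polyDiff X.poly v (X.exists_polyDiff_ne_zero v).choose)⁻¹ •
    (detForm (X.exists_polyDiff_ne_zero v).choose v).compLinearMap (X.tangent v).subtype

variable {X}

theorem residueForm_apply {v : X.cone} {n : Vec4} (hn : polyDiff X.poly v n ≠ 0)
    (w : Fin 2 → X.tangent v) :
    X.residueForm v w = (polyDiff X.poly v n)⁻¹ * detForm n v fun i => (w i : Vec4) :=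
  inv_mul_detForm_eq (X.exists_polyDiff_ne_zero v).choose_spec hn (X.polyDiff_self v.2)
    fun i => (w i).2

theorem residueForm_map (A : Vec4 →ₗ[ℂ] Vec4) {k : ℂ} (hk : k ≠ 0)
    (hA : ∀ x, eval (A x) X.poly = k * eval x X.poly) {v v' : X.cone} (hv : (v' : Vec4) = A v)
    {w : Fin 2 → X.tangent v} {w' : Fin 2 → X.tangent v'}
    (hw : ∀ i, (w' i : Vec4) = A (w i : Vec4)) :
    X.residueForm v' w' = LinearMap.det A / k * X.residueForm v w := by
  obtain ⟨n, hn⟩ := X.exists_polyDiff_ne_zero v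
  have hd : polyDiff X.poly v' (A n) = k * polyDiff X.poly v n :=
    hv ▸ differential_map_of_eval_map A hA v n
  have hdet : detForm (A n) v' (fun i => (w' i : Vec4)) =
      LinearMap.det A * detForm n v fun i => (w i : Vec4) := by
    simpa only [hv, hw] using detForm_map A n v fun i => (w i : Vec4)
  rw [residueForm_apply hn, residueForm_apply (n := A n) (hd ▸ mul_ne_zero hk hn), hd, hdet]
  field_simp

variable (X) in
theorem residueForm_mem_H20 : X.residueForm ∈ X.H20 := by
  refine ⟨fun v w hw => ?_, fun c v v' hv w w' hw => ?_, fun v₀ => ?_⟩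
  · obtain ⟨n, hn⟩ := X.exists_polyDiff_ne_zero v
    rw [residueForm_apply hn, detForm_eq_zero_of_apply_eq n 0 hw, mul_zero]
  · have hc : c ≠ 0 := fun hc => v'.2.1 (by rw [hv, hc, zero_smul])
    have hc4 : c ^ 4 ≠ 0 := pow_ne_zero 4 hc
    have hA (x : Vec4) : (c • LinearMap.id : Vec4 →ₗ[ℂ] Vec4) x = c • x := rfl
    have hF (x : Vec4) : eval ((c • LinearMap.id : Vec4 →ₗ[ℂ] Vec4) x) X.poly =
        c ^ 4 * eval x X.poly := by
      rw [hA, eval_smul_of_isHomogeneous X.homogeneous]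
    rw [residueForm_map _ hc4 hF (hv.trans (hA _).symm) fun i => (hw i).trans (hA _).symm,
      LinearMap.det_smul, LinearMap.det_id, Module.finrank_fin_fun, mul_one, div_self hc4, one_mul]
  · obtain ⟨n, hn⟩ := X.exists_polyDiff_ne_zero v₀
    refine ⟨{x | polyDiff X.poly x n ≠ 0}, ?_, hn,
      fun x => (polyDiff X.poly x n)⁻¹ • detForm n x, fun w => ?_,
      fun v hv w => residueForm_apply hv w⟩
    · exact isOpen_ne_fun (differentiable_polyDiff _ _).continuous continuous_const
    · exact ((differentiable_polyDiff _ _).differentiableOn.inv fun x hx => hx).mul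
        (differentiable_detForm _ _).differentiableOn

theorem exists_residueForm_ne_zero (v : X.cone) : ∃ w, X.residueForm v w ≠ 0 := by
  obtain ⟨n, hn⟩ := X.exists_polyDiff_ne_zero v
  obtain ⟨w, hw, hne⟩ := exists_detForm_ne_zero hn (X.polyDiff_self v.2) v.2.1
  refine ⟨fun i => ⟨w i, hw i⟩, ?_⟩
  rw [residueForm_apply hn]
  exact mul_ne_zero (inv_ne_zero hn) hne

theorem Symmetry.not_isSymplectic {τ : X.Symmetry} {A : Vec4 ≃ₗ[ℂ] Vec4} (hA : τ.IsLift A)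
    {k : ℂ} (hk : k ≠ 0) (hF : ∀ x, eval (A x) X.poly = k * eval x X.poly)
    (hdet : LinearMap.det A.toLinearMap ≠ k) (hX : X.cone.Nonempty) : ¬ τ.IsSymplectic := by
  intro h
  obtain ⟨v, hv⟩ := hX
  obtain ⟨w, hw⟩ := exists_residueForm_ne_zero ⟨v, hv⟩
  have hid : X.residueForm ⟨A v, hA.map_mem_cone v hv⟩
      (fun i => X.tangentMap A hA.map_mem_cone ⟨v, hv⟩ (w i)) = X.residueForm ⟨v, hv⟩ w :=
    congrArg (fun T => (T ⟨X.residueForm, X.residueForm_mem_H20⟩).1 ⟨v, hv⟩ w) (h A hA)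
  rw [residueForm_map A.toLinearMap hk hF (v := ⟨v, hv⟩) rfl fun i => rfl,
    mul_eq_right₀ hw, div_eq_one_iff_eq hk] at hid
  exact hdet hid

end SmoothQuartic

end ResidueForm

section LinearAlgebra

theorem smul_mk_eq_self_iff {K V : Type*} [DivisionRing K] [AddCommGroup V] [Module K V]
    (A : V ≃ₗ[K] V) {v : V} (hv : v ≠ 0) :
    A • Projectivization.mk K v hv = Projectivization.mk K v hv ↔ ∃ c : K, A v = c • v := by
  rw [Projectivization.smul_mk, Projectivization.mk_eq_mk_iff']
  exact exists_congr fun c => eq_comm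

theorem exists_forall_apply_eq_smul {K V W : Type*} [Field K] [AddCommGroup V] [Module K V]
    [AddCommGroup W] [Module K W] {i f : V →ₗ[K] W} (hi : Function.Injective i)
    (h : ∀ v, ∃ c : K, f v = c • i v) : ∃ c : K, ∀ v, f v = c • i v := by
  obtain ⟨r, hr⟩ := i.exists_leftInverse_of_injective (LinearMap.ker_eq_bot.2 hi)
  have hri (v : V) : r (i v) = v := LinearMap.congr_fun hr v
  obtain ⟨c, hc⟩ : ∃ c : K, r ∘ₗ f = c • 1 := by
    refine LinearMap.exists_eq_smul_id_of_forall_notLinearIndependent fun v hli => ?_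
    obtain ⟨c, hc⟩ := h v
    have hrel : c • v + (-1 : K) • (r ∘ₗ f) v = 0 := by simp [hc, hri]
    simpa using (LinearIndependent.pair_iff.1 hli c (-1) hrel).2
  refine ⟨c, fun v => ?_⟩
  obtain ⟨d, hd⟩ := h v
  have hcd : d • v = c • v := by simpa [hd, hri] using LinearMap.congr_fun hc v
  rw [hd, ← map_smul, hcd, map_smul]

variable (R σ τ : Type*) [CommRing R]

/-- The involution `(a, b) ↦ (a, -b)`. -/
def negRight : (σ ⊕ τ → R) ≃ₗ[R] (σ ⊕ τ → R) :=
  LinearEquiv.piCongrRight (Sum.rec (fun _ => LinearEquiv.refl R R) fun _ => LinearEquiv.neg R)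

variable {R σ τ}

theorem negRight_sumElim (a : σ → R) (b : τ → R) :
    negRight R σ τ (Sum.elim a b) = Sum.elim a (-b) := by
  ext (i | i) <;> rfl

theorem det_negRight [Finite σ] [Fintype τ] :
    LinearMap.det (negRight R σ τ).toLinearMap = (-1) ^ Fintype.card τ := by
  classical
  cases nonempty_fintype σ
  have h : (negRight R σ τ).toLinearMap =
      Matrix.toLin' (Matrix.diagonal (Sum.elim (fun _ => 1) fun _ => -1)) := by
    refine LinearMap.ext fun x => funext fun i => ?_
    cases i <;> simp [negRight, Matrix.mulVec_diagonal]
  rw [h, LinearMap.det_toLin', Matrix.det_diagonal, Fintype.prod_sum_type]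
  simp

end LinearAlgebra

section MiddleCoefficient

theorem eq_zero_of_forall_root_smul_root {K : Type*} [Field K] [IsAlgClosed K] {a b c ρ : K}
    (ha : a ≠ 0) (hρ0 : ρ ≠ 0) (hρ1 : ρ ≠ 1)
    (h : ∀ z, a + b * z + c * z ^ 2 = 0 → a + b * (ρ * z) + c * (ρ * z) ^ 2 = 0) : b = 0 := by
  by_contra hb
  obtain ⟨z, hz⟩ : ∃ z, a + b * z + c * z ^ 2 = 0 := by
    obtain ⟨z, hz⟩ := IsAlgClosed.exists_root
      (Polynomial.C a + Polynomial.C b * Polynomial.X + Polynomial.C c * Polynomial.X ^ 2)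
      fun hdeg => hb (by
        simpa [Polynomial.coeff_X, Polynomial.coeff_C] using
          congrArg (Polynomial.coeff · 1) (Polynomial.eq_C_of_degree_eq_zero hdeg))
    exact ⟨z, by simpa using hz⟩
  have hz0 : z ≠ 0 := by
    rintro rfl
    exact ha (by simpa using hz)
  have h₁ := h z hz
  have h₂ := h _ h₁
  have hzρ : (ρ - 1) * z ≠ 0 := mul_ne_zero (sub_ne_zero.2 hρ1) hz0
  have hsum : b + c * z * (ρ + 1) = 0 :=
    mul_left_cancel₀ hzρ (by linear_combination h₁ - hz)
  have hsum' : b + c * (ρ * z) * (ρ + 1) = 0 :=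
    mul_left_cancel₀ (mul_ne_zero hρ0 hzρ) (by linear_combination h₂ - h₁)
  have hprod : c * (ρ + 1) = 0 :=
    mul_left_cancel₀ hzρ (by linear_combination hsum' - hsum)
  exact hb (by linear_combination hsum - z * hprod)

end MiddleCoefficient

namespace SmoothQuartic

variable {X : SmoothQuartic}

/-- The symmetry of `X` induced by a linear map that preserves its equation up to a factor. -/
def symmetryOfEval (A : Vec4 ≃ₗ[ℂ] Vec4) {k : ℂ} (hk : k ≠ 0)
    (hF : ∀ x, eval (A x) X.poly = k * eval x X.poly) : X.Symmetry where
  aut := MulAction.toPermHom (Vec4 ≃ₗ[ℂ] Vec4) P3 A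
  aut_mem := ⟨A, rfl⟩
  preserves p := by
    induction p using Projectivization.ind with | h v hv =>
    have hAv : A v ≠ 0 := A.map_ne_zero_iff.2 hv
    change Projectivization.mk ℂ (A v) hAv ∈ X.surface ↔ _
    rw [X.mk_mem_surface, X.mk_mem_surface, cone, Set.mem_ofPred_eq, Set.mem_ofPred_eq, hF,
      mul_eq_zero_iff_left hk, and_iff_right hv, and_iff_right hAv]

namespace Symmetry

theorem isLift_symmetryOfEval (A : Vec4 ≃ₗ[ℂ] Vec4) {k : ℂ} (hk : k ≠ 0)
    (hF : ∀ x, eval (A x) X.poly = k * eval x X.poly) : (symmetryOfEval A hk hF).IsLift A :=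
  fun _ => rfl

theorem exists_isLift (τ : X.Symmetry) : ∃ A, τ.IsLift A := by
  obtain ⟨A, hA⟩ := τ.aut_mem
  exact ⟨A, fun p => by rw [← hA]; rfl⟩

theorem fixX_eq_inter (τ : X.Symmetry) : τ.fixX = τ.fixP3 ∩ X.surface := by
  ext p
  constructor
  · rintro ⟨x, hx, rfl⟩
    exact ⟨congrArg Subtype.val hx, x.2⟩
  · rintro ⟨hp, hpX⟩
    exact ⟨⟨p, hpX⟩, Subtype.ext hp, rfl⟩

theorem orderOf_onSurface_eq_two {τ : X.Symmetry} {A : Vec4 ≃ₗ[ℂ] Vec4} (hA : τ.IsLift A)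
    (hAA : ∀ v, A (A v) = v) (hfix : ¬ X.surface ⊆ τ.fixP3) : orderOf τ.onSurface = 2 := by
  refine orderOf_eq_prime ?_ fun h => ?_
  · have hAA' : A * A = 1 := LinearEquiv.ext hAA
    ext p
    change τ.aut (τ.aut p) = p
    rw [hA, hA, smul_smul, hAA', one_smul]
  · obtain ⟨p, hpX, hp⟩ := Set.not_subset.1 hfix
    exact hp (congrArg Subtype.val (Equiv.Perm.congr_fun h ⟨p, hpX⟩))

end Symmetry

end SmoothQuartic

namespace AdaptedCoordinates

variable {l' l'' : Set P3} (B : AdaptedCoordinates l' l'') {X : SmoothQuartic}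

/-- The involution `diag (1, 1, -1, -1)` in the coordinates `B`. -/
def involution : Vec4 ≃ₗ[ℂ] Vec4 :=
  (B.toEquiv.symm.trans (negRight ℂ (Fin 2) (Fin 2))).trans B.toEquiv

theorem involution_toEquiv (a b : Fin 2 → ℂ) :
    B.involution (B.toEquiv (Sum.elim a b)) = B.toEquiv (Sum.elim a (-b)) := by
  simp [involution, negRight_sumElim]

theorem exists_eq_toEquiv_sumElim (v : Vec4) : ∃ a b, v = B.toEquiv (Sum.elim a b) :=
  ⟨_, _, by rw [Sum.elim_comp_inl_inr, B.toEquiv.apply_symm_apply]⟩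

theorem involution_involution (v : Vec4) : B.involution (B.involution v) = v := by
  obtain ⟨a, b, rfl⟩ := B.exists_eq_toEquiv_sumElim v
  rw [involution_toEquiv, involution_toEquiv, neg_neg]

theorem det_involution : LinearMap.det B.involution.toLinearMap = 1 := by
  have h := LinearMap.det_conj (negRight ℂ (Fin 2) (Fin 2)).toLinearMap B.toEquiv
  rw [det_negRight, Fintype.card_fin, neg_one_sq] at h
  exact h

theorem eval_involution (h' : l' ⊆ X.surface) (h'' : l'' ⊆ X.surface)
    (h : bihomogeneousComponent 2 2 (B.form X) = 0) (v : Vec4) :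
    eval (B.involution v) X.poly = -1 * eval v X.poly := by
  obtain ⟨a, b, rfl⟩ := B.exists_eq_toEquiv_sumElim v
  have h₁ := B.eval_form_sumElim_smul h' h'' a b 1 1
  have h₂ := B.eval_form_sumElim_smul h' h'' a b 1 (-1)
  rw [h, map_zero] at h₁ h₂
  rw [one_smul, one_smul] at h₁
  rw [one_smul, neg_one_smul] at h₂
  rw [involution_toEquiv, ← eval_form, ← eval_form]
  linear_combination h₁ + h₂

theorem involution_smul_eq_self_iff {p : P3} : B.involution • p = p ↔ p ∈ l' ∪ l'' := by
  obtain ⟨x, hx, rfl⟩ := B.exists_eq_point p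
  rw [Set.mem_union, point_mem_left, point_mem_right, point, smul_mk_eq_self_iff]
  obtain ⟨a, b, rfl⟩ : ∃ a b, x = Sum.elim a b := ⟨_, _, (Sum.elim_comp_inl_inr x).symm⟩
  simp only [involution_toEquiv, ← map_smul, B.toEquiv.injective.eq_iff, Sum.elim_comp_inl,
    Sum.elim_comp_inr]
  constructor
  · rintro ⟨c, hc⟩
    have ha : (1 - c) • a = 0 := by
      rw [sub_smul, one_smul, sub_eq_zero]
      exact congrArg (· ∘ Sum.inl) hc
    have hb : (1 + c) • b = 0 := by
      rw [add_smul, one_smul, add_comm, ← eq_neg_iff_add_eq_zero]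
      exact (congrArg (· ∘ Sum.inr) hc).symm
    by_cases hc1 : c = 1
    · exact .inl ((smul_eq_zero_iff_right (by norm_num [hc1])).1 hb)
    · exact .inr ((smul_eq_zero_iff_right (sub_ne_zero.2 (Ne.symm hc1))).1 ha)
  · rintro (rfl | rfl)
    · exact ⟨1, by simp⟩
    · exact ⟨-1, by ext (i | i) <;> simp⟩

theorem exists_symmetry (h' : l' ⊆ X.surface) (h'' : l'' ⊆ X.surface)
    (h : bihomogeneousComponent 2 2 (B.form X) = 0) (hX : ¬ X.surface ⊆ l' ∪ l'') :
    ∃ τ : X.Symmetry, ¬ τ.IsSymplectic ∧ orderOf τ.onSurface = 2 ∧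
      τ.fixX = l' ∪ l'' ∧ τ.fixP3 = l' ∪ l'' := by
  have hneg : (-1 : ℂ) ≠ 0 := neg_ne_zero.2 one_ne_zero
  have hF := B.eval_involution h' h'' h
  let τ := SmoothQuartic.symmetryOfEval B.involution hneg hF
  have hlift : τ.IsLift B.involution := SmoothQuartic.Symmetry.isLift_symmetryOfEval _ _ _
  have hfix : τ.fixP3 = l' ∪ l'' := Set.ext fun p => B.involution_smul_eq_self_iff
  have hcone : X.cone.Nonempty := by
    obtain ⟨p, hp, -⟩ := Set.not_subset.1 hX
    exact ⟨p.rep, p.rep_nonzero, hp⟩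
  refine ⟨τ, SmoothQuartic.Symmetry.not_isSymplectic hlift hneg hF ?_ hcone,
    SmoothQuartic.Symmetry.orderOf_onSurface_eq_two hlift B.involution_involution (hfix ▸ hX),
    ?_, hfix⟩
  · rw [det_involution]
    norm_num
  · rw [τ.fixX_eq_inter, hfix, Set.inter_eq_left]
    exact Set.union_subset h' h''

theorem smul_point_eq_self_iff (A : Vec4 ≃ₗ[ℂ] Vec4) {x : Fin 2 ⊕ Fin 2 → ℂ} (hx : x ≠ 0) :
    A • B.point x hx = B.point x hx ↔ ∃ c : ℂ, A (B.toEquiv x) = c • B.toEquiv x :=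
  smul_mk_eq_self_iff A _

theorem exists_forall_apply_left_eq_smul {A : Vec4 ≃ₗ[ℂ] Vec4} (hA : ∀ p ∈ l', A • p = p) :
    ∃ α : ℂ, ∀ a, A (B.toEquiv (Sum.elim a 0)) = B.toEquiv (Sum.elim (α • a) 0) := by
  let i : (Fin 2 → ℂ) →ₗ[ℂ] Vec4 := B.toEquiv.toLinearMap ∘ₗ
    (LinearEquiv.sumArrowLequivProdArrow _ _ ℂ ℂ).symm.toLinearMap ∘ₗ LinearMap.inl _ _ _
  have hi (a : Fin 2 → ℂ) : i a = B.toEquiv (Sum.elim a 0) := rfl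
  have hinj : Function.Injective i := fun _ _ h =>
    congrArg (· ∘ Sum.inl) (B.toEquiv.injective h)
  obtain ⟨α, hα⟩ := exists_forall_apply_eq_smul (f := A.toLinearMap ∘ₗ i) hinj fun a => by
    rcases eq_or_ne a 0 with rfl | ha
    · exact ⟨0, by simp⟩
    · exact (B.smul_point_eq_self_iff A (sumElim_ne_zero_of_left ha 0)).1
        (hA _ ((B.point_mem_left _).2 rfl))
  exact ⟨α, fun a => (hα a).trans (by rw [← map_smul, hi])⟩

theorem exists_forall_apply_right_eq_smul {A : Vec4 ≃ₗ[ℂ] Vec4} (hA : ∀ p ∈ l'', A • p = p) :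
    ∃ β : ℂ, ∀ b, A (B.toEquiv (Sum.elim 0 b)) = B.toEquiv (Sum.elim 0 (β • b)) := by
  let i : (Fin 2 → ℂ) →ₗ[ℂ] Vec4 := B.toEquiv.toLinearMap ∘ₗ
    (LinearEquiv.sumArrowLequivProdArrow _ _ ℂ ℂ).symm.toLinearMap ∘ₗ LinearMap.inr _ _ _
  have hi (b : Fin 2 → ℂ) : i b = B.toEquiv (Sum.elim 0 b) := rfl
  have hinj : Function.Injective i := fun _ _ h =>
    congrArg (· ∘ Sum.inr) (B.toEquiv.injective h)
  obtain ⟨β, hβ⟩ := exists_forall_apply_eq_smul (f := A.toLinearMap ∘ₗ i) hinj fun b => by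
    rcases eq_or_ne b 0 with rfl | hb
    · exact ⟨0, by simp⟩
    · exact (B.smul_point_eq_self_iff A (sumElim_ne_zero_of_right 0 hb)).1
        (hA _ ((B.point_mem_right _).2 rfl))
  exact ⟨β, fun b => (hβ b).trans (by rw [← map_smul, hi])⟩

theorem exists_scalars_of_fixedPoints_eq {A : Vec4 ≃ₗ[ℂ] Vec4}
    (hA : ∀ p : P3, A • p = p ↔ p ∈ l' ∪ l'') : ∃ α β : ℂ, α ≠ 0 ∧ β ≠ 0 ∧ α ≠ β ∧
      ∀ a b, A (B.toEquiv (Sum.elim a b)) = B.toEquiv (Sum.elim (α • a) (β • b)) := by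
  obtain ⟨α, hα⟩ := B.exists_forall_apply_left_eq_smul fun p hp => (hA p).2 (.inl hp)
  obtain ⟨β, hβ⟩ := B.exists_forall_apply_right_eq_smul fun p hp => (hA p).2 (.inr hp)
  have hsum (a b : Fin 2 → ℂ) :
      Sum.elim a b = Sum.elim a (0 : Fin 2 → ℂ) + Sum.elim (0 : Fin 2 → ℂ) b := by
    ext (i | i) <;> simp
  have hAB (a b : Fin 2 → ℂ) :
      A (B.toEquiv (Sum.elim a b)) = B.toEquiv (Sum.elim (α • a) (β • b)) := by
    rw [hsum, map_add, map_add, hα, hβ, ← map_add, ← hsum]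
  have hne {x : Fin 2 ⊕ Fin 2 → ℂ} (hx : x ≠ 0) : A (B.toEquiv x) ≠ 0 :=
    A.map_ne_zero_iff.2 (B.toEquiv_ne_zero hx)
  refine ⟨α, β, ?_, ?_, ?_, hAB⟩
  · rintro rfl
    exact hne (sumElim_ne_zero_of_left (one_ne_zero (α := Fin 2 → ℂ)) 0) (by simp [hα])
  · rintro rfl
    exact hne (sumElim_ne_zero_of_right 0 (one_ne_zero (α := Fin 2 → ℂ))) (by simp [hβ])
  · rintro rfl
    have hone := sumElim_ne_zero_of_left (one_ne_zero (α := Fin 2 → ℂ)) (1 : Fin 2 → ℂ)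
    have hscalar : A (B.toEquiv (Sum.elim 1 1)) = α • B.toEquiv (Sum.elim 1 1) := by
      rw [hAB, ← map_smul]
      congr 1
      ext (i | i) <;> simp
    rcases (hA _).1 ((B.smul_point_eq_self_iff A hone).2 ⟨α, hscalar⟩) with h | h
    · exact one_ne_zero ((B.point_mem_left hone).1 h)
    · exact one_ne_zero ((B.point_mem_right hone).1 h)

theorem bihomogeneousComponent_two_two_eq_zero_of_stable (h' : l' ⊆ X.surface)
    (h'' : l'' ⊆ X.surface) {α β : ℂ} (hα : α ≠ 0) (hβ : β ≠ 0) (hαβ : α ≠ β)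
    (hstable : ∀ a b, eval (Sum.elim a b) (B.form X) = 0 →
      eval (Sum.elim (α • a) (β • b)) (B.form X) = 0) :
    bihomogeneousComponent 2 2 (B.form X) = 0 := by
  have hprod : bihomogeneousComponent 3 1 (B.form X) * bihomogeneousComponent 2 2 (B.form X) =
      0 := by
    refine MvPolynomial.funext fun x => ?_
    obtain ⟨a, b, rfl⟩ : ∃ a b, x = Sum.elim a b := ⟨_, _, (Sum.elim_comp_inl_inr x).symm⟩
    rw [map_mul, map_zero, mul_eq_zero, or_iff_not_imp_left]
    intro hf
    have hρ : β / α ≠ 1 := fun h => hαβ ((div_eq_one_iff_eq hα).1 h).symm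
    refine eq_zero_of_forall_root_smul_root
      (c := eval (Sum.elim a b) (bihomogeneousComponent 1 3 (B.form X))) hf
      (div_ne_zero hβ hα) hρ fun z hz => ?_
    have hz0 : z ≠ 0 := by
      rintro rfl
      exact hf (by simpa using hz)
    have hroot : eval (Sum.elim a (z • b)) (B.form X) = 0 := by
      have hab := B.eval_form_sumElim_smul h' h'' a b 1 z
      rw [one_smul] at hab
      linear_combination hab + z * hz
    have hroot' := hstable a (z • b) hroot
    rw [smul_smul, B.eval_form_sumElim_smul h' h'', mul_eq_zero_iff_left
      (mul_ne_zero hα (mul_ne_zero hβ hz0))] at hroot'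
    field_simp
    linear_combination hroot'
  obtain ⟨b, hb⟩ := exists_eval_bihomogeneousComponent_ne_zero
    (B.sum_bihomogeneousComponent_form h' h'') (B.isNonsingular_form X)
    (one_ne_zero (α := Fin 2 → ℂ))
  exact (mul_eq_zero.1 hprod).resolve_left fun h => hb (by rw [h, map_zero])

theorem bihomogeneousComponent_two_two_eq_zero_of_fixP3_eq (h' : l' ⊆ X.surface)
    (h'' : l'' ⊆ X.surface) {τ : X.Symmetry} (hfix : τ.fixP3 = l' ∪ l'') :
    bihomogeneousComponent 2 2 (B.form X) = 0 := by
  obtain ⟨A, hlift⟩ := τ.exists_isLift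
  obtain ⟨α, β, hα, hβ, hαβ, hA⟩ := B.exists_scalars_of_fixedPoints_eq (A := A) fun p => by
    rw [← hlift, ← hfix, SmoothQuartic.Symmetry.fixP3, Set.mem_ofPred_eq]
  refine B.bihomogeneousComponent_two_two_eq_zero_of_stable h' h'' hα hβ hαβ fun a b hab => ?_
  rw [eval_form, ← hA]
  rcases eq_or_ne (Sum.elim a b) 0 with h0 | h0
  · rwa [h0, map_zero, map_zero, ← map_zero B.toEquiv, ← eval_form, ← h0]
  · exact (hlift.map_mem_cone _ ⟨B.toEquiv_ne_zero h0, by rwa [← eval_form]⟩).2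

end AdaptedCoordinates

theorem SmoothQuartic.AreTwinLines.not_surface_subset {X : SmoothQuartic} {l' l'' : Set P3}
    (h : X.AreTwinLines l' l'') : ¬ X.surface ⊆ l' ∪ l'' := by
  obtain ⟨hl', hl'', -, -, hdisj, m, -, hm⟩ := h
  obtain ⟨hline, hmX, -, -, hm', hm''⟩ := hm 0
  obtain ⟨B⟩ := nonempty_adaptedCoordinates hl' hl'' hdisj
  obtain ⟨a, b, ha, hb, hab⟩ := B.exists_eq_joinLine hline hm' hm''
  intro hX
  have hp : B.point _ (sumElim_ne_zero_of_left ha b) ∈ m 0 :=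
    hab ▸ (B.point_mem_joinLine _).2 ⟨1, 1, by simp⟩
  rcases hX (hmX hp) with h | h
  · exact hb ((B.point_mem_left _).1 h)
  · exact ha ((B.point_mem_right _).1 h)

end

theorem mainTheorem3 (X : SmoothQuartic) (l' l'' : Set P3)
    (hl' : IsLine l') (hl'' : IsLine l'')
    (hX' : l' ⊆ X.surface) (hX'' : l'' ⊆ X.surface) (hdisj : Disjoint l' l'') :
    X.AreTwinLines l' l'' ↔
      ∃ τ : X.Symmetry, ¬ τ.IsSymplectic ∧ orderOf τ.onSurface = 2 ∧
        τ.fixX = l' ∪ l'' ∧ τ.fixP3 = l' ∪ l'' := by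
  obtain ⟨B⟩ := nonempty_adaptedCoordinates hl' hl'' hdisj
  constructor
  · intro h
    exact B.exists_symmetry hX' hX'' (B.bihomogeneousComponent_two_two_eq_zero h)
      h.not_surface_subset
  · rintro ⟨τ, -, -, -, hfix⟩
    exact B.areTwinLines hl' hl'' hdisj hX' hX''
      (B.bihomogeneousComponent_two_two_eq_zero_of_fixP3_eq hX' hX'' hfix)
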